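/- Conventions. Functionals are linear and unital on $\mathbb{C}\langle x_1,\dots,x_d\rangle$ (non-commuting variables, $x_i^*=x_i$); a state is a functional that is moreover $*$-compatible and satisfies $\varphi[P^*P]\ge 0$. For a functional $\varphi$ let $M^\varphi(\mathbf z)=\sum_{|u|\ge1}\varphi[x_u]z_u$, $\eta^\varphi=1-(1+M^\varphi)^{-1}$ (Boolean cumulants), and let $R^\varphi$ be the series with $M^\varphi(\mathbf w)=R^\varphi((1+M^\varphi(\mathbf w))\mathbf w)$ (free cumulants). The convolutions and their real powers are the functionals determined by $R^{\varphi\boxplus\psi}=R^\varphi+R^\psi$, $R^{\varphi^{\boxplus t}}=tR^\varphi$, $\eta^{\varphi\uplus\psi}=\eta^\varphi+\eta^\psi$, $\eta^{\varphi^{\uplus t}}=t\eta^\varphi$; $\delta_{\mathbf a}[P]=P(a_1,\dots,a_d)$ for $\mathbf a\in\mathbb{R}^d$. Define $\Phi[\rho,\psi]$ by $\eta^{\Phi[\rho,\psi]}(\mathbf w)=(1+M^\psi(\mathbf w))^{-1}R^\rho((1+M^\psi(\mathbf w))\mathbf w)$, and, for $\mathbf a\in\mathbb{R}^d$ and real $t\ne-1$,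 $$B_{\mathbf a,t}[\rho]=\bigl((\rho^{\boxplus(1+t)}\boxplus\delta_{\mathbf a})\uplus\delta_{-\mathbf a}\bigr)^{\uplus 1/(1+t)}.$$ A probability measure on $\mathbb{R}$ with finite moments is identified, in these formulas, with its moment functional on $\mathbb{C}\langle x_1\rangle$. For $b\in\mathbb{R}$, $c\ge-1$, the free Meixner distribution $\mu_{b,c}$ is the probability measure on $\mathbb{R}$ with Jacobi parameter sequences $(0,b,b,\dots)$, $(1,1+c,1+c,\dots)$. With the left derivatives $D_i(z_iz_u)=z_u$, $D_i(z_jz_u)=0$ for $j\neq i$, $D_i1=0$, the free Meixner state $\varphi_{\{T_i\},C}$, where $T_i=(B_{ij}^k)_{j,k}$ are complex $d\times d$ matrices and $C=(C_{ij})$ is real, identified with the operator $e_i\otimes e_j\mapsto C_{ij}\,e_i\otimes e_j$, is the state with zero means such that, for all $i,j$, $$D_iD_jR^\varphi=\delta_{ij}+\sum_kB_{ij}^kD_kR^\varphi+C_{ij}\,D_iR^\varphi\,D_jR^\varphi .$$ Lemma. (0) For all $b\in\mathbb{R}$, $c\ge-1$ the measure $\mu_{b,c}$ exists and is unique. If all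 $T_i$ are Hermitian, all $C_{ij}\ge-1$, and each $T_i\otimes I$ commutes with $C$, then $\varphi_{\{T_i\},C}$ exists and is unique. (a) If $c\ge-1$, $c+t\ge-1$, $t\neq-1$ and $\alpha\in\mathbb{R}$, then $B_{\alpha,t}[\mu_{b,c}]=\mu_{b+\alpha,c+t}$; in particular it is again a free Meixner distribution. (b) If $\varphi_{\{T_i\},C}$ is a free Meixner state, $\mathbf a\in\mathbb{R}^d$, $t\ne-1$ and $t+C_{ij}\ge-1$ for all $i,j$, then $B_{\mathbf a,t}[\varphi_{\{T_i\},C}]=\varphi_{\{a_iI+T_i\},\,tI+C}$; in particular it is again a free Meixner state. (c) $\mu_{0,-1}=\tfrac12\delta_{-1}+\tfrac12\delta_1$, and for every free Meixner distribution $\mu_{b,c}$ there are $\alpha\in\mathbb{R}$ and $t\ge0$ with $B_{\alpha,t}\bigl[\tfrac12\delta_{-1}+\tfrac12\delta_1\bigr]=\mu_{b,c}$. (d) If $c\ge-1$, $c+t\ge-1$ and $\alpha\in\mathbb{R}$, then $\Phi\bigl[\mu_{b,c},\ \mu_{b,c}^{\boxplus(1+t)}\boxplus\delta_\alpha\bigr]=\mu_{b+\alpha,c+t}$,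 and this equals $B_{\alpha,t}[\mu_{b,c}]$ if $t\ne-1$. -/

import Mathlib

open MeasureTheory

/-! ### Non-commutative formal power series -/

/-- Formal power series with complex coefficients in `d` non-commuting variables: a series is
the family of its coefficients, indexed by words in the letters `0, …, d - 1`. -/
def NCSeries (d : ℕ) : Type := List (Fin d) → ℂ

namespace NCSeries

variable {d : ℕ}

noncomputable instance : AddCommGroup (NCSeries d) :=
  inferInstanceAs (AddCommGroup (List (Fin d) → ℂ))

noncomputable instance : Module ℂ (NCSeries d) :=
  inferInstanceAs (Module ℂ (List (Fin d) → ℂ))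

@[ext]
theorem ext {f g : NCSeries d} (h : ∀ w, f w = g w) : f = g := funext h

theorem zero_apply (w : List (Fin d)) : (0 : NCSeries d) w = 0 := rfl
theorem add_apply (f g : NCSeries d) (w : List (Fin d)) : (f + g) w = f w + g w := rfl
theorem neg_apply (f : NCSeries d) (w : List (Fin d)) : (-f) w = -f w := rfl
theorem sub_apply (f g : NCSeries d) (w : List (Fin d)) : (f - g) w = f w - g w := rfl
theorem smul_apply (c : ℂ) (f : NCSeries d) (w : List (Fin d)) : (c • f) w = c * f w := rfl

/-- The product of series: sum over all ways to cut the word in two. -/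
noncomputable instance : Mul (NCSeries d) :=
  ⟨fun f g w => ∑ i ∈ Finset.range (w.length + 1), f (w.take i) * g (w.drop i)⟩

noncomputable instance : One (NCSeries d) := ⟨fun w => if w = [] then 1 else 0⟩

theorem mul_apply (f g : NCSeries d) (w : List (Fin d)) :
    (f * g) w = ∑ i ∈ Finset.range (w.length + 1), f (w.take i) * g (w.drop i) := rfl

theorem one_apply (w : List (Fin d)) : (1 : NCSeries d) w = if w = [] then 1 else 0 := rfl

/-- The left partial derivative: `D i (z_i z_u) = z_u`, `D i (z_j z_u) = 0` for `j ≠ i`,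
`D i 1 = 0`. -/
def D (i : Fin d) (f : NCSeries d) : NCSeries d := fun w => f (i :: w)

theorem D_apply (i : Fin d) (f : NCSeries d) (w : List (Fin d)) : D i f w = f (i :: w) := rfl

theorem mul_nil (f g : NCSeries d) : (f * g) [] = f [] * g [] := by
  simp [mul_apply]

theorem mul_cons (f g : NCSeries d) (a : Fin d) (w : List (Fin d)) :
    (f * g) (a :: w) = (D a f * g) w + f [] * g (a :: w) := by
  rw [mul_apply, mul_apply, List.length_cons, Finset.sum_range_succ']
  simp [D_apply]

theorem D_mul (a : Fin d) (f g : NCSeries d) : D a (f * g) = D a f * g + f [] • D a g := by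
  ext w
  rw [D_apply, mul_cons, add_apply, smul_apply, D_apply]

protected theorem add_mul' (f g h : NCSeries d) : (f + g) * h = f * h + g * h := by
  ext w
  simp only [mul_apply, add_apply, add_mul, Finset.sum_add_distrib]

protected theorem mul_add' (f g h : NCSeries d) : f * (g + h) = f * g + f * h := by
  ext w
  simp only [mul_apply, add_apply, mul_add, Finset.sum_add_distrib]

protected theorem smul_mul' (c : ℂ) (f g : NCSeries d) : (c • f) * g = c • (f * g) := by
  ext w
  simp only [mul_apply, smul_apply, Finset.mul_sum, mul_assoc]

protected theorem zero_mul' (f : NCSeries d) : 0 * f = 0 := by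
  ext w
  simp [mul_apply, zero_apply]

protected theorem mul_zero' (f : NCSeries d) : f * 0 = 0 := by
  ext w
  simp [mul_apply, zero_apply]

theorem D_one (a : Fin d) : D a (1 : NCSeries d) = 0 := by
  ext w
  simp [D_apply, one_apply, zero_apply]

protected theorem one_mul' (f : NCSeries d) : 1 * f = f := by
  ext w
  cases w with
  | nil => simp [mul_nil, one_apply]
  | cons a w => rw [mul_cons, D_one, NCSeries.zero_mul']; simp [zero_apply, one_apply]

protected theorem mul_one' (f : NCSeries d) : f * 1 = f := by
  ext w
  induction w generalizing f with
  | nil => simp [mul_nil, one_apply]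
  | cons a w ih => rw [mul_cons, ih]; simp [D_apply, one_apply]

protected theorem mul_assoc' (f g h : NCSeries d) : f * g * h = f * (g * h) := by
  ext w
  induction w generalizing f g h with
  | nil => simp [mul_nil, mul_assoc]
  | cons a w ih =>
    rw [mul_cons, mul_cons, mul_cons, D_mul, NCSeries.add_mul', add_apply, ih,
      NCSeries.smul_mul', smul_apply, mul_nil]
    ring

noncomputable instance : Ring (NCSeries d) :=
  { (inferInstance : AddCommGroup (NCSeries d)) with
    mul := (· * ·)
    one := 1
    left_distrib := NCSeries.mul_add'
    right_distrib := NCSeries.add_mul'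
    zero_mul := NCSeries.zero_mul'
    mul_zero := NCSeries.mul_zero'
    mul_assoc := NCSeries.mul_assoc'
    one_mul := NCSeries.one_mul'
    mul_one := NCSeries.mul_one' }

/-- The variable `z_i`. -/
noncomputable def X (i : Fin d) : NCSeries d := fun w => if w = [i] then 1 else 0

/-- Substitution `R(F_1, …, F_d) = ∑_u R_u F_{u(1)} ⋯ F_{u(n)}` of series `F_i` without constant
term. Since the `F_i` have no constant term, words `u` longer than `w` do not contribute to the
coefficient of `w`, so the sum is finite. -/
noncomputable def subst (R : NCSeries d) (F : Fin d → NCSeries d) : NCSeries d :=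
  fun w => ∑ n ∈ Finset.range (w.length + 1), ∑ u : Fin n → Fin d,
    R (List.ofFn u) * ((List.ofFn fun k => F (u k)).prod : NCSeries d) w

/-! #### Fixed points of maps that raise the order of agreement -/

/-- Agreement of the coefficients of all words of length less than `n`. -/
def Agree (n : ℕ) (f g : NCSeries d) : Prop := ∀ w : List (Fin d), w.length < n → f w = g w

theorem existsUnique_fixed (F : NCSeries d → NCSeries d)
    (hF : ∀ n f g, Agree n f g → Agree (n + 1) (F f) (F g)) : ∃! f, f = F f := by
  have h1 : ∀ k, Agree k (F^[k] 0) (F^[k + 1] 0) := by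
    intro k
    induction k with
    | zero => intro w hw; exact absurd hw (Nat.not_lt_zero _)
    | succ k ih =>
      rw [Function.iterate_succ_apply', Function.iterate_succ_apply' F (k + 1)]
      exact hF _ _ _ ih
  have h2 : ∀ k m, Agree k (F^[k] 0) (F^[k + m] 0) := by
    intro k m
    induction m with
    | zero => intro w _; rfl
    | succ m ih =>
      intro w hw
      rw [ih w hw]
      exact h1 (k + m) w (by omega)
  refine ⟨fun w => (F^[w.length + 1] 0) w, ?_, ?_⟩
  · ext w
    have h3 : Agree w.length (F^[w.length] 0) (fun v => (F^[v.length + 1] 0) v) := by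
      intro v hv
      have := h2 (v.length + 1) (w.length - (v.length + 1)) v (Nat.lt_succ_self _)
      rw [show v.length + 1 + (w.length - (v.length + 1)) = w.length by omega] at this
      exact this.symm
    have h4 := hF _ _ _ h3 w (Nat.lt_succ_self _)
    rw [← h4, ← Function.iterate_succ_apply' F]
  · intro g hg
    have h5 : ∀ k, Agree k (F^[k] 0) g := by
      intro k
      induction k with
      | zero => intro w hw; exact absurd hw (Nat.not_lt_zero _)
      | succ k ih =>
        have := hF _ _ _ ih
        rw [← hg, ← Function.iterate_succ_apply' F] at this
        exact this
    ext w
    exact (h5 (w.length + 1) w (Nat.lt_succ_self _)).symm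

theorem agree_mul {n : ℕ} {f f' g g' : NCSeries d} (hf : Agree n f f') (hg : Agree n g g') :
    Agree n (f * g) (f' * g') := by
  intro w hw
  rw [mul_apply, mul_apply]
  refine Finset.sum_congr rfl fun i _ => ?_
  rw [hf _ (lt_of_le_of_lt (List.length_take_le' _ _) hw),
    hg _ (lt_of_le_of_lt (by simp) hw)]

theorem agree_mul_left {n : ℕ} {f g g' : NCSeries d} (hf : f [] = 0) (hg : Agree n g g') :
    Agree (n + 1) (f * g) (f * g') := by
  intro w hw
  rw [mul_apply, mul_apply]
  refine Finset.sum_congr rfl fun i hi => ?_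
  rcases Nat.eq_zero_or_pos i with rfl | hi0
  · simp [hf]
  · rcases w with _ | ⟨a, w⟩
    · simp [hf]
    · rw [hg _ (by simp at hw ⊢; omega)]

theorem agree_mul_right {n : ℕ} {f g g' : NCSeries d} (hf : f [] = 0) (hg : Agree n g g') :
    Agree (n + 1) (g * f) (g' * f) := by
  intro w hw
  rw [mul_apply, mul_apply]
  refine Finset.sum_congr rfl fun i hi => ?_
  rcases Nat.lt_or_ge i w.length with h | h
  · rw [hg _ (by simp; omega)]
  · rw [List.drop_eq_nil_of_le h, hf, mul_zero, mul_zero]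

/-- A series with constant term `1` is invertible. -/
theorem isUnit_one_add {f : NCSeries d} (hf : f [] = 0) : IsUnit (1 + f) := by
  obtain ⟨g, hg, -⟩ := existsUnique_fixed (fun g => 1 - f * g) (by
    intro n g g' h w hw
    rw [sub_apply, sub_apply, agree_mul_left hf h w hw])
  obtain ⟨k, hk, -⟩ := existsUnique_fixed (fun g => 1 - g * f) (by
    intro n g g' h w hw
    rw [sub_apply, sub_apply, agree_mul_right hf h w hw])
  have h1 : (1 + f) * g = 1 := by
    rw [add_mul, one_mul]; nth_rewrite 1 [hg]; abel
  have h2 : k * (1 + f) = 1 := by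
    rw [mul_add, mul_one]; nth_rewrite 1 [hk]; abel
  have h3 : k = g := left_inv_eq_right_inv h2 h1
  exact ⟨⟨1 + f, g, h1, h3 ▸ h2⟩, rfl⟩

/-- The change of variables `z_i = (1 + M(w)) w_i`. -/
noncomputable def chg (M : NCSeries d) (i : Fin d) : NCSeries d := (1 + M) * X i

theorem X_nil (i : Fin d) : (X i : NCSeries d) [] = 0 := by simp [X]

theorem chg_nil (M : NCSeries d) (i : Fin d) : chg M i [] = 0 := by
  rw [chg, mul_nil, X_nil, mul_zero]

theorem agree_chg {n : ℕ} {M M' : NCSeries d} (h : Agree n M M') (i : Fin d) :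
    Agree (n + 1) (chg M i) (chg M' i) :=
  agree_mul_right (X_nil i) fun w hw => by rw [add_apply, add_apply, h w hw]

theorem agree_prod {n : ℕ} {M M' : NCSeries d} (h : Agree n M M') (u : List (Fin d)) :
    Agree (n + 1) (u.map (chg M)).prod (u.map (chg M')).prod := by
  induction u with
  | nil => intro w _; rfl
  | cons a u ih =>
    rw [List.map_cons, List.map_cons, List.prod_cons, List.prod_cons]
    exact agree_mul (agree_chg h a) ih

theorem ofFn_chg (M : NCSeries d) {n : ℕ} (u : Fin n → Fin d) :
    (List.ofFn fun k => chg M (u k)) = (List.ofFn u).map (chg M) := by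
  rw [List.map_ofFn]; rfl

/-- A free cumulant series determines the moment series. -/
theorem existsUnique_moment (R : NCSeries d) : ∃! M : NCSeries d, M = subst R (chg M) := by
  refine existsUnique_fixed (fun M => subst R (chg M)) ?_
  intro n M M' h w hw
  refine Finset.sum_congr rfl fun m _ => Finset.sum_congr rfl fun u _ => ?_
  rw [ofFn_chg, ofFn_chg, agree_prod h _ w hw]

theorem prod_chg_low (M : NCSeries d) (u w : List (Fin d)) (h : w.length < u.length) :
    (u.map (chg M)).prod w = 0 := by
  induction u generalizing w with
  | nil => simp at h
  | cons a u ih =>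
    rw [List.map_cons, List.prod_cons, mul_apply]
    refine Finset.sum_eq_zero fun i _ => ?_
    rcases Nat.eq_zero_or_pos i with rfl | hi
    · simp [chg_nil]
    · rcases w with _ | ⟨b, w⟩
      · simp [chg_nil]
      · rw [ih _ (by simp at h ⊢; omega), mul_zero]

theorem prod_chg_top (M : NCSeries d) (hM : M [] = 0) (u w : List (Fin d))
    (h : w.length = u.length) : (u.map (chg M)).prod w = if u = w then 1 else 0 := by
  induction u generalizing w with
  | nil => simp at h; subst h; simp [one_apply]
  | cons a u ih =>
    rcases w with _ | ⟨b, w⟩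
    · simp at h
    · have hw : w.length = u.length := by simpa using h
      rw [List.map_cons, List.prod_cons, mul_cons, chg_nil, zero_mul, add_zero, mul_apply,
        Finset.sum_eq_single 0]
      · have h1 : D b (chg M a) [] = if a = b then 1 else 0 := by
          rw [D_apply, chg, mul_cons, mul_nil, X_nil, mul_zero, zero_add, add_apply, hM]
          simp [one_apply, X, eq_comm]
        simp only [List.take_zero, List.drop_zero]
        rw [h1, ih w hw]
        by_cases hab : a = b <;> by_cases huw : u = w <;> simp [hab, huw]
      · intro i hi hi0
        rcases w with _ | ⟨c, w⟩
        · simp at hi; omega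
        · rw [prod_chg_low _ _ _ (by simp at hw ⊢; omega), mul_zero]
      · simp

/-- A moment series determines the free cumulant series. -/
theorem existsUnique_cumulant (M : NCSeries d) (hM : M [] = 0) :
    ∃! R : NCSeries d, M = subst R (chg M) := by
  have key := existsUnique_fixed (d := d) (fun R => fun w => M w -
    ∑ n ∈ Finset.range w.length, ∑ u : Fin n → Fin d,
      R (List.ofFn u) * ((List.ofFn fun k => chg M (u k)).prod : NCSeries d) w) (by
    intro n f g h w hw
    simp only
    congr 1
    refine Finset.sum_congr rfl fun m hm => Finset.sum_congr rfl fun u _ => ?_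
    rw [h _ (by simp at hm ⊢; omega)])
  have top : ∀ (R : NCSeries d) (w : List (Fin d)), (∑ u : Fin w.length → Fin d,
      R (List.ofFn u) * ((List.ofFn fun k => chg M (u k)).prod : NCSeries d) w) = R w := by
    intro R w
    rw [Finset.sum_eq_single w.get]
    · rw [ofFn_chg, prod_chg_top M hM _ _ (by simp)]; simp
    · intro u _ hu
      rw [ofFn_chg, prod_chg_top M hM _ _ (by simp), if_neg, mul_zero]
      intro h
      exact hu (List.ofFn_injective (h.trans (List.ofFn_get w).symm))
    · simp
  have equiv : ∀ R : NCSeries d, M = subst R (chg M) ↔ R = fun w => M w -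
    ∑ n ∈ Finset.range w.length, ∑ u : Fin n → Fin d,
      R (List.ofFn u) * ((List.ofFn fun k => chg M (u k)).prod : NCSeries d) w := by
    intro R
    constructor
    · intro h
      ext w
      have := congrFun h w
      rw [subst, Finset.sum_range_succ, top] at this
      rw [this]; ring
    · intro h
      ext w
      rw [subst, Finset.sum_range_succ, top]
      have := congrFun h w
      rw [this]; ring
  simpa only [equiv] using key

/-- The free cumulant series `R` of a moment series `M` (without constant term), defined by
the implicit equation `M(w) = R((1 + M(w)) w)`. -/
noncomputable def freeCumulant (M : NCSeries d) (hM : M [] = 0) : NCSeries d :=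
  (existsUnique_cumulant M hM).choose

/-- The moment series `M` with given free cumulant series `R`: `M(w) = R((1 + M(w)) w)`. -/
noncomputable def momentOfFree (R : NCSeries d) : NCSeries d := (existsUnique_moment R).choose

end NCSeries

/-! ### Functionals on non-commutative polynomials -/

/-- Linear functionals on `ℂ⟨x_1, …, x_d⟩`. -/
abbrev NCFunctional (d : ℕ) : Type := FreeAlgebra ℂ (Fin d) →ₗ[ℂ] ℂ

namespace NCFunctional

open NCSeries

variable {d : ℕ}

/-- The monomial `x_u` of a word `u`. -/
noncomputable def monomial (u : List (Fin d)) : FreeAlgebra ℂ (Fin d) :=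
  (u.map (FreeAlgebra.ι ℂ)).prod

/-- The unital functional with prescribed moments `φ[x_u] = m u` for all non-empty words `u`. -/
noncomputable def ofMoments (m : NCSeries d) : NCFunctional d :=
  (FreeAlgebra.basisFreeMonoid ℂ (Fin d)).constr ℂ
    fun u => if u.toList = [] then 1 else m u.toList

theorem basis_eq_monomial (u : FreeMonoid (Fin d)) :
    FreeAlgebra.basisFreeMonoid ℂ (Fin d) u = monomial u.toList := by
  rw [FreeAlgebra.basisFreeMonoid, Module.Basis.map_apply, Finsupp.coe_basisSingleOne]
  change MonoidAlgebra.lift ℂ (FreeAlgebra ℂ (Fin d)) (FreeMonoid (Fin d))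
    (FreeMonoid.lift (FreeAlgebra.ι ℂ)) (MonoidAlgebra.single u 1) = _
  rw [MonoidAlgebra.lift_single, one_smul, FreeMonoid.lift_apply, monomial]

theorem ofMoments_monomial (m : NCSeries d) (u : List (Fin d)) :
    ofMoments m (monomial u) = if u = [] then 1 else m u := by
  have := basis_eq_monomial (FreeMonoid.ofList u)
  rw [FreeMonoid.toList_ofList] at this
  rw [← this, ofMoments, Module.Basis.constr_basis, FreeMonoid.toList_ofList]

/-- The moment generating function `M^φ(z) = ∑ φ[x_u] z_u`, over non-empty words `u`. -/
noncomputable def M (φ : NCFunctional d) : NCSeries d :=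
  fun u => if u = [] then 0 else φ (monomial u)

theorem M_nil (φ : NCFunctional d) : φ.M [] = 0 := by simp [M]

/-- The Boolean cumulant generating function `η^φ = 1 - (1 + M^φ)⁻¹`. -/
noncomputable def eta (φ : NCFunctional d) : NCSeries d := 1 - Ring.inverse (1 + φ.M)

/-- The free cumulant generating function `R^φ`, with `M^φ(w) = R^φ((1 + M^φ(w)) w)`. -/
noncomputable def R (φ : NCFunctional d) : NCSeries d := freeCumulant φ.M φ.M_nil

/-- The unital functional with Boolean cumulant generating function `h` (a series without
constant term): its moment generating function is `(1 - h)⁻¹ - 1`. -/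
noncomputable def ofEta (h : NCSeries d) : NCFunctional d := ofMoments (Ring.inverse (1 - h) - 1)

/-- The unital functional with free cumulant generating function `r` (a series without constant
term). -/
noncomputable def ofR (r : NCSeries d) : NCFunctional d := ofMoments (momentOfFree r)

/-- The free convolution `φ ⊞ ψ`. -/
noncomputable def boxplus (φ ψ : NCFunctional d) : NCFunctional d := ofR (φ.R + ψ.R)

/-- The Boolean convolution `φ ⊎ ψ`. -/
noncomputable def uplus (φ ψ : NCFunctional d) : NCFunctional d := ofEta (φ.eta + ψ.eta)

/-- The free convolution power `φ^{⊞ t}`, as a functional, for real `t`. -/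
noncomputable def boxpow (φ : NCFunctional d) (t : ℝ) : NCFunctional d := ofR ((t : ℂ) • φ.R)

/-- The Boolean convolution power `φ^{⊎ t}`, as a functional, for real `t`. -/
noncomputable def upow (φ : NCFunctional d) (t : ℝ) : NCFunctional d := ofEta ((t : ℂ) • φ.eta)

/-- The functional `δ_a[P] = P(a_1, …, a_d)`. -/
noncomputable def delta (a : Fin d → ℝ) : NCFunctional d :=
  (FreeAlgebra.lift ℂ fun i => (a i : ℂ)).toLinearMap

/-- The functional `Φ[ρ, ψ]`, with `η^{Φ[ρ, ψ]}(w) = (1 + M^ψ(w))⁻¹ R^ρ((1 + M^ψ(w)) w)`. -/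
noncomputable def Phi (ρ ψ : NCFunctional d) : NCFunctional d :=
  ofEta (Ring.inverse (1 + ψ.M) * subst ρ.R (chg ψ.M))

/-- The transformation `B_{a, t}[ρ] = ((ρ^{⊞ (1 + t)} ⊞ δ_a) ⊎ δ_{-a})^{⊎ 1 / (1 + t)}`,
for `t ≠ -1`. -/
noncomputable def BT (a : Fin d → ℝ) (t : ℝ) (ρ : NCFunctional d) : NCFunctional d :=
  (((ρ.boxpow (1 + t)).boxplus (delta a)).uplus (delta (-a))).upow (1 / (1 + t))

/-- The involution of `ℂ⟨x_1, …, x_d⟩`: conjugate-linear, reversing monomials, `x_i^* = x_i`. -/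
noncomputable def adj (P : FreeAlgebra ℂ (Fin d)) : FreeAlgebra ℂ (Fin d) :=
  ((FreeAlgebra.basisFreeMonoid ℂ (Fin d)).repr P).sum
    fun u c => starRingEnd ℂ c • monomial u.toList.reverse

/-- States: unital, `*`-compatible, positive functionals. (By `*`-compatibility `φ[P^* P]` is
real.) -/
structure IsState (φ : NCFunctional d) : Prop where
  unital : φ 1 = 1
  star_compat : ∀ P, φ (adj P) = starRingEnd ℂ (φ P)
  nonneg : ∀ P, 0 ≤ (φ (adj P * P)).re

/-- `φ` is the free Meixner state `φ_{{T_i}, C}` (normalized to mean zero; the equation for the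
constant terms then says that the covariance is the identity). Here `T i j k = B_{ij}^k`, so
`T_i` is a `d × d` matrix, and `C` stands for the diagonal operator
`e_i ⊗ e_j ↦ C_{ij} e_i ⊗ e_j` on `ℂ^d ⊗ ℂ^d`. The product on the right is that of series. -/
structure IsFreeMeixnerState (T : Fin d → Matrix (Fin d) (Fin d) ℂ)
    (C : Matrix (Fin d) (Fin d) ℝ) (φ : NCFunctional d) : Prop where
  isState : IsState φ
  mean_zero : ∀ i, φ (FreeAlgebra.ι ℂ i) = 0
  quadratic : ∀ i j, D i (D j φ.R) = (if i = j then 1 else 0) + ∑ k, T i j k • D k φ.R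
    + (C i j : ℂ) • (D i φ.R * D j φ.R)

/-- The functional on `ℂ⟨x_1⟩` given by integration against a measure on `ℝ`. -/
noncomputable def ofMeasure (μ : Measure ℝ) : NCFunctional 1 :=
  ofMoments fun u => ((∫ x, x ^ u.length ∂μ : ℝ) : ℂ)

end NCFunctional

/-! ### Free Meixner distributions -/

/-- The monic polynomials with `P_0 = 1`, `P_1 = x - β_0` and
`x P_n = P_{n+1} + β_n P_n + γ_n P_{n-1}`. -/
noncomputable def jacobiPoly (β γ : ℕ → ℝ) : ℕ → Polynomial ℝ
  | 0 => 1
  | 1 => Polynomial.X - Polynomial.C (β 0)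
  | n + 2 => (Polynomial.X - Polynomial.C (β (n + 1))) * jacobiPoly β γ (n + 1)
      - Polynomial.C (γ (n + 1)) * jacobiPoly β γ n

/-- `μ` is a probability measure on `ℝ` with finite moments and with Jacobi parameter sequences
`(β_0, β_1, …)`, `(γ_1, γ_2, …)` (the value `γ 0` is not used): the monic polynomials given by
the three-term recursion are orthogonal with respect to `μ`. -/
structure HasJacobiParameters (β γ : ℕ → ℝ) (μ : Measure ℝ) : Prop where
  isProb : IsProbabilityMeasure μ
  moments : ∀ n : ℕ, Integrable (fun x : ℝ => x ^ n) μ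
  orthogonal : ∀ m n, m ≠ n →
    ∫ x, (jacobiPoly β γ m).eval x * (jacobiPoly β γ n).eval x ∂μ = 0

/-- `μ` is the free Meixner distribution `μ_{b, c}` (mean zero, variance one): its Jacobi
parameter sequences are `(0, b, b, …)` and `(1, 1 + c, 1 + c, …)`. -/
def IsFreeMeixner (b c : ℝ) (μ : Measure ℝ) : Prop :=
  HasJacobiParameters (fun n => if n = 0 then 0 else b) (fun n => if n = 1 then 1 else 1 + c) μ

/-- The Bernoulli distribution `(δ_{-1} + δ_1) / 2`. -/
noncomputable def bernoulliSym : Measure ℝ :=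
  (1 / 2 : ENNReal) • Measure.dirac (-1) + (1 / 2 : ENNReal) • Measure.dirac 1

/-!
Dividing the quadratic equation for `R` by `1 + M` and using the product rule for the left
derivatives turns it into the same equation with `C + 1` for `C`, satisfied by `η`: Boolean
cumulants of a free Meixner state solve a quadratic equation too. Replacing `R` by
`(1 + t) R + a · z` inside the substitution changes that equation only in its coefficients,
`C_{ij}` becoming `t + C_{ij}` and `T_i` becoming `a_i + T_i`; and `B_{a, t}[φ]` is
`Φ[φ, φ^{⊞ (1 + t)} ⊞ δ_a]`. Since the equation can be solved recursively, this determines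
`B_{a, t}[φ]`.

Positivity comes from the equation for `η`. It says that the moments are the vacuum moments of
the operators `X_i = a_i^+ + T_i + a_i^-` on a Fock space in which `‖e_i ⊗ e_j ⊗ ξ‖²` is
`(1 + C_{ij}) ‖e_j ⊗ ξ‖²`. These are symmetric when the `T_i` are Hermitian and `T_i ⊗ 1` commutes
with `C`, and both conditions can be read off from the symmetry of the cumulants of a given state.

In one variable the operator `X_1` acts on the basis vectors by the three-term recursion of the
orthogonal polynomials of `μ_{b, c}`. The measure itself is the spectral measure of the
corresponding bounded Jacobi matrix, and it is unique because its moments are bounded by powers of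
a constant.
-/

namespace NCSeries

variable {d : ℕ}

noncomputable instance : Algebra ℂ (NCSeries d) :=
  Algebra.ofModule NCSeries.smul_mul' fun c f g => by
    ext w
    simp only [mul_apply, smul_apply, Finset.mul_sum, mul_left_comm]

/-- The involution of series that conjugates the coefficients and reverses the words. -/
noncomputable instance : StarRing (NCSeries d) where
  star f := fun w => starRingEnd ℂ (f w.reverse)
  star_involutive f := by
    ext w
    change starRingEnd ℂ (starRingEnd ℂ (f w.reverse.reverse)) = f w
    rw [List.reverse_reverse, Complex.conj_conj]
  star_mul f g := by
    ext w
    change starRingEnd ℂ (∑ i ∈ Finset.range (w.reverse.length + 1),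
        f (w.reverse.take i) * g (w.reverse.drop i)) =
      ∑ i ∈ Finset.range (w.length + 1),
        starRingEnd ℂ (g (w.take i).reverse) * starRingEnd ℂ (f (w.drop i).reverse)
    rw [List.length_reverse, ← Finset.sum_range_reflect, map_sum]
    refine Finset.sum_congr rfl fun i hi => ?_
    have hi' : w.length - (w.length - i) = i :=
      Nat.sub_sub_self (Nat.le_of_lt_succ (Finset.mem_range.mp hi))
    rw [Nat.add_sub_cancel, List.take_reverse, List.drop_reverse, hi', map_mul, mul_comm]
  star_add f g := by
    ext w
    exact map_add (starRingEnd ℂ) (f w.reverse) (g w.reverse)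

theorem star_apply (f : NCSeries d) (w : List (Fin d)) :
    star f w = starRingEnd ℂ (f w.reverse) := rfl

theorem one_nil : (1 : NCSeries d) [] = 1 := if_pos rfl

theorem sum_apply {ι : Type*} (s : Finset ι) (f : ι → NCSeries d) (w : List (Fin d)) :
    (∑ i ∈ s, f i) w = ∑ i ∈ s, f i w :=
  Finset.sum_apply w s f

theorem D_add (i : Fin d) (f g : NCSeries d) : D i (f + g) = D i f + D i g := rfl

theorem D_sub (i : Fin d) (f g : NCSeries d) : D i (f - g) = D i f - D i g := rfl

theorem D_smul (i : Fin d) (c : ℂ) (f : NCSeries d) : D i (c • f) = c • D i f := rfl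

theorem D_zero (i : Fin d) : D i (0 : NCSeries d) = 0 := rfl

theorem D_sum {ι : Type*} (i : Fin d) (s : Finset ι) (f : ι → NCSeries d) :
    D i (∑ k ∈ s, f k) = ∑ k ∈ s, D i (f k) := by
  ext w
  simp only [D_apply, sum_apply]

theorem D_X (i j : Fin d) : D i (X j : NCSeries d) = if i = j then 1 else 0 := by
  ext w
  by_cases h : i = j <;> simp [D_apply, X, h, one_apply, zero_apply]

theorem D_sum_X_mul (i : Fin d) (f : Fin d → NCSeries d) : D i (∑ j, X j * f j) = f i := by
  simp only [D_sum, D_mul, D_X, X_nil, zero_smul, add_zero, ite_mul, one_mul, zero_mul,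
    Finset.sum_ite_eq, Finset.mem_univ, if_true]

theorem ext_D {f g : NCSeries d} (h0 : f [] = g []) (h : ∀ i, D i f = D i g) : f = g := by
  ext w
  cases w with
  | nil => exact h0
  | cons a w => exact congrFun (h a) w

theorem isUnit_one_sub {h : NCSeries d} (hh : h [] = 0) : IsUnit (1 - h) := by
  rw [sub_eq_add_neg]
  exact isUnit_one_add (by rw [neg_apply, hh, neg_zero])

theorem inverse_nil {f : NCSeries d} (hf : IsUnit f) (h0 : f [] = 1) :
    Ring.inverse f [] = 1 := by
  have h := congrFun (Ring.mul_inverse_cancel f hf) []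
  rwa [mul_nil, h0, one_mul, one_nil] at h

/-! ### Substitution is a homomorphism -/

theorem subst_add (f g : NCSeries d) (F : Fin d → NCSeries d) :
    subst (f + g) F = subst f F + subst g F := by
  ext w
  simp only [subst, add_apply, add_mul, Finset.sum_add_distrib]

theorem subst_smul (c : ℂ) (f : NCSeries d) (F : Fin d → NCSeries d) :
    subst (c • f) F = c • subst f F := by
  ext w
  simp only [subst, smul_apply, Finset.mul_sum, mul_assoc]

section Subst

variable {F : Fin d → NCSeries d} (hF : ∀ i, F i [] = 0)
include hF

theorem prod_map_apply_eq_zero {u w : List (Fin d)} (h : w.length < u.length) :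
    (u.map F).prod w = 0 := by
  induction u generalizing w with
  | nil => exact absurd h (Nat.not_lt_zero _)
  | cons a u ih =>
    rw [List.map_cons, List.prod_cons, mul_apply]
    refine Finset.sum_eq_zero fun k _ => ?_
    rcases k with _ | k
    · rw [List.take_zero, hF, zero_mul]
    · rcases w with _ | ⟨b, w⟩
      · rw [List.take_nil, hF, zero_mul]
      · rw [ih (by simp only [List.length_drop, List.length_cons] at h ⊢; omega), mul_zero]

theorem subst_apply_of_length_lt (R : NCSeries d) {N : ℕ} {w : List (Fin d)}
    (hN : w.length < N) :
    subst R F w = ∑ n ∈ Finset.range N, ∑ u : Fin n → Fin d,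
      R (List.ofFn u) * ((List.ofFn u).map F).prod w := by
  simp only [subst, List.map_ofFn, Function.comp_def]
  refine Finset.sum_subset (Finset.range_mono hN) fun n _ hn => ?_
  refine Finset.sum_eq_zero fun u _ => ?_
  have h := prod_map_apply_eq_zero hF (u := List.ofFn u) (w := w) (by simpa using hn)
  rw [List.map_ofFn] at h
  exact mul_eq_zero_of_right _ h

theorem mul_subst_apply (R : NCSeries d) (i : Fin d) (w : List (Fin d)) :
    (F i * subst R F) w = ∑ n ∈ Finset.range w.length, ∑ u : Fin n → Fin d,
      R (List.ofFn u) * (F i * ((List.ofFn u).map F).prod) w := by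
  simp only [mul_apply (F i), Finset.mul_sum]
  rw [Finset.sum_congr rfl fun n _ => Finset.sum_comm, Finset.sum_comm]
  refine Finset.sum_congr rfl fun k _ => ?_
  rcases k with _ | k
  · simp only [List.take_zero, hF, zero_mul, mul_zero, Finset.sum_const_zero]
  · rcases w with _ | ⟨a, w⟩
    · simp only [List.take_nil, hF, zero_mul, mul_zero, Finset.sum_const_zero]
    · rw [subst_apply_of_length_lt hF R (N := (a :: w).length)
        (by simp only [List.length_drop, List.length_cons]; omega)]
      simp only [Finset.mul_sum, mul_left_comm]

theorem subst_eq_add_sum (R : NCSeries d) :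
    subst R F = R [] • 1 + ∑ i, F i * subst (D i R) F := by
  ext w
  rw [subst_apply_of_length_lt hF R (Nat.lt_succ_self _), Finset.sum_range_succ', add_apply,
    sum_apply, Finset.sum_congr rfl fun i _ => mul_subst_apply hF (D i R) i w, add_comm,
    Finset.sum_comm]
  congr 1
  · simp [smul_apply]
  · refine Finset.sum_congr rfl fun n _ => ?_
    rw [← (Fin.consEquiv fun _ => Fin d).sum_comp, Fintype.sum_prod_type]
    simp [Fin.consEquiv, List.ofFn_succ, D_apply]

theorem subst_nil (R : NCSeries d) : subst R F [] = R [] := by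
  rw [subst_eq_add_sum hF]
  simp [add_apply, smul_apply, one_nil, sum_apply, mul_nil, hF]

theorem subst_one : subst 1 F = 1 := by
  have h0 : subst (0 : NCSeries d) F = 0 := by simpa using subst_smul 0 0 F
  rw [subst_eq_add_sum hF]
  simp only [one_nil, one_smul, D_one, h0, mul_zero, Finset.sum_const_zero, add_zero]

theorem agree_subst_mul (n : ℕ) (f g : NCSeries d) :
    Agree n (subst (f * g) F) (subst f F * subst g F) := by
  induction n generalizing f with
  | zero => exact fun w hw => absurd hw (Nat.not_lt_zero _)
  | succ n ih =>
    have h1 : subst (f * g) F = f [] • subst g F + ∑ i, F i * subst (D i f * g) F := by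
      rw [subst_eq_add_sum hF (f * g), subst_eq_add_sum hF g, mul_nil]
      simp only [D_mul, subst_add, subst_smul, mul_add, Finset.sum_add_distrib, smul_add,
        mul_smul, mul_smul_comm, Finset.smul_sum]
      abel
    have h2 : subst f F * subst g F =
        f [] • subst g F + ∑ i, F i * (subst (D i f) F * subst g F) := by
      rw [subst_eq_add_sum hF f, add_mul, Finset.sum_mul, smul_mul_assoc, one_mul]
      simp only [mul_assoc]
    intro w hw
    rw [h1, h2, add_apply, add_apply, sum_apply, sum_apply]
    congr 1
    exact Finset.sum_congr rfl fun i _ => agree_mul_left (hF i) (ih (D i f)) w hw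

/-- Substitution of series without constant term, as an algebra homomorphism. -/
noncomputable def substAlgHom : NCSeries d →ₐ[ℂ] NCSeries d :=
  AlgHom.ofLinearMap
    { toFun := fun R => subst R F
      map_add' := fun f g => subst_add f g F
      map_smul' := fun c f => subst_smul c f F }
    (subst_one hF) fun f g => by
      ext w
      exact agree_subst_mul hF _ f g w (Nat.lt_succ_self _)

theorem substAlgHom_apply (R : NCSeries d) : substAlgHom hF R = subst R F := rfl

theorem substAlgHom_X (i : Fin d) : substAlgHom hF (X i) = F i := by
  rw [substAlgHom_apply, subst_eq_add_sum hF, X_nil, zero_smul, zero_add]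
  simp only [D_X, ← substAlgHom_apply hF, apply_ite (substAlgHom hF), map_one, map_zero,
    mul_ite, mul_one, mul_zero, Finset.sum_ite_eq', Finset.mem_univ, if_true]

end Subst

section SubstChg

variable {M : NCSeries d} (hM : M [] = 0)
include hM

theorem inverse_mul_subst_chg {R : NCSeries d} (hR : R [] = 0) :
    Ring.inverse (1 + M) * subst R (chg M) = ∑ i, X i * subst (D i R) (chg M) := by
  rw [subst_eq_add_sum (chg_nil M), hR, zero_smul, zero_add, Finset.mul_sum]
  refine Finset.sum_congr rfl fun i _ => ?_
  rw [chg, mul_assoc, Ring.inverse_mul_cancel_left _ _ (isUnit_one_add hM)]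

theorem D_inverse_mul_subst_chg {R : NCSeries d} (hR : R [] = 0) (i : Fin d) :
    D i (Ring.inverse (1 + M) * subst R (chg M)) = subst (D i R) (chg M) := by
  rw [inverse_mul_subst_chg hM hR, D_sum_X_mul]

theorem subst_chg_injective : Function.Injective fun R => subst R (chg M) := by
  refine (injective_iff_map_eq_zero (substAlgHom (chg_nil M))).2 fun R hR => ?_
  ext w
  induction w generalizing R with
  | nil => rw [← subst_nil (chg_nil M) R, ← substAlgHom_apply (chg_nil M), hR]
  | cons i _ ih =>
    have hR0 : R [] = 0 := by
      rw [← subst_nil (chg_nil M) R, ← substAlgHom_apply (chg_nil M), hR, zero_apply]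
    refine ih (D i R) ?_
    rw [substAlgHom_apply, ← D_inverse_mul_subst_chg hM hR0, ← substAlgHom_apply (chg_nil M),
      hR, mul_zero, D_zero]

end SubstChg

end NCSeries

/-! ### The quadratic equation -/

namespace NCSeries

variable {d : ℕ}

/-- The quadratic equation `D_i D_j h = δ_{ij} + ∑_k T_{ijk} D_k h + C_{ij} D_i h D_j h`, for a
series `h` without terms of order less than two. It is satisfied by the free cumulants of the
free Meixner state `φ_{{T_i}, C}`, and by its Boolean cumulants with `1 + C_{ij}` for `C_{ij}`. -/
structure IsMeixnerSeries (T : Fin d → Matrix (Fin d) (Fin d) ℂ)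
    (C : Matrix (Fin d) (Fin d) ℝ) (h : NCSeries d) : Prop where
  nil : h [] = 0
  singleton : ∀ i, h [i] = 0
  quadratic : ∀ i j, D i (D j h) = (if i = j then 1 else 0) + ∑ k, T i j k • D k h
    + (C i j : ℂ) • (D i h * D j h)

theorem Agree.D {n : ℕ} {f g : NCSeries d} (h : Agree n f g) (i : Fin d) :
    Agree (n - 1) (D i f) (D i g) :=
  fun w hw => h (i :: w) (by rw [List.length_cons]; omega)

theorem agree_quadratic {n : ℕ} {f g : NCSeries d} (h : Agree n f g) (i j : Fin d)
    (t : Fin d → ℂ) (c : ℂ) :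
    Agree (n - 1) ((if i = j then 1 else 0) + ∑ k, t k • D k f + c • (D i f * D j f))
      ((if i = j then 1 else 0) + ∑ k, t k • D k g + c • (D i g * D j g)) := by
  intro w hw
  simp only [add_apply, sum_apply, smul_apply, agree_mul (h.D i) (h.D j) w hw]
  simp only [(h.D _) w hw]

theorem existsUnique_isMeixnerSeries (T : Fin d → Matrix (Fin d) (Fin d) ℂ)
    (C : Matrix (Fin d) (Fin d) ℝ) : ∃! h, IsMeixnerSeries T C h := by
  let Q (h : NCSeries d) : NCSeries d := fun
    | j :: i :: v => ((if i = j then 1 else 0) + ∑ k, T i j k • D k h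
        + (C i j : ℂ) • (D i h * D j h) : NCSeries d) v
    | _ => 0
  have agree_Q : ∀ n f g, Agree n f g → Agree (n + 1) (Q f) (Q g) := by
    intro n f g h w hw
    match w with
    | [] => rfl
    | [_] => rfl
    | j :: i :: v =>
      exact agree_quadratic h i j (T i j) (C i j) v (by simp only [List.length_cons] at hw; omega)
  have eq_Q_iff : ∀ h, h = Q h ↔ IsMeixnerSeries T C h := fun h =>
    { mp := fun e => ⟨congrFun e [], fun i => congrFun e [i],
        fun i j => funext fun v => congrFun e (j :: i :: v)⟩
      mpr := fun H => funext fun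
        | [] => H.nil
        | [i] => H.singleton i
        | j :: i :: v => congrFun (H.quadratic i j) v }
  simpa only [eq_Q_iff] using existsUnique_fixed Q agree_Q

theorem mul_pair {f g : NCSeries d} (hf : f [] = 0) (hg : g [] = 0) (a b : Fin d) :
    (f * g) [a, b] = f [a] * g [b] := by
  simp [mul_apply, Finset.sum_range_succ, hf, hg]

theorem mul_triple {f g : NCSeries d} (hf : f [] = 0) (hg : g [] = 0) (a b c : Fin d) :
    (f * g) [a, b, c] = f [a] * g [b, c] + f [a, b] * g [c] := by
  simp [mul_apply, Finset.sum_range_succ, hf, hg]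

namespace IsMeixnerSeries

variable {T : Fin d → Matrix (Fin d) (Fin d) ℂ} {C : Matrix (Fin d) (Fin d) ℝ} {h : NCSeries d}

theorem apply_cons_cons (H : IsMeixnerSeries T C h) (i j : Fin d) (v : List (Fin d)) :
    h (j :: i :: v) = (if i = j then (1 : NCSeries d) v else 0) + ∑ k, T i j k * h (k :: v)
      + C i j * (D i h * D j h) v := by
  have h1 := congrFun (H.quadratic i j) v
  rw [add_apply, add_apply, smul_apply, sum_apply] at h1
  refine h1.trans ?_
  congr 2
  split_ifs <;> rfl

theorem apply_pair (H : IsMeixnerSeries T C h) (i j : Fin d) :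
    h [j, i] = if i = j then 1 else 0 := by
  rw [H.apply_cons_cons, mul_nil, D_apply]
  simp [H.singleton, one_nil]

theorem apply_triple (H : IsMeixnerSeries T C h) (i j l : Fin d) : h [j, i, l] = T i j l := by
  rw [H.apply_cons_cons]
  simp [H.apply_pair, H.singleton, one_apply, mul_apply, Finset.sum_range_succ, D_apply]

theorem apply_four (H : IsMeixnerSeries T C h) (i j l m : Fin d) :
    h [j, i, l, m] = (T i * T l) j m + if i = l ∧ j = m then (C i j : ℂ) else 0 := by
  rw [H.apply_cons_cons, mul_pair (H.singleton i) (H.singleton j), D_apply, D_apply,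
    H.apply_pair, H.apply_pair, Matrix.mul_apply]
  simp only [H.apply_triple, one_apply, eq_comm (a := l), eq_comm (a := m)]
  by_cases hil : i = l <;> by_cases hjm : j = m <;> simp [hil, hjm]

theorem apply_five (H : IsMeixnerSeries T C h) (i j l m n : Fin d) :
    h [j, i, l, m, n] = (T i * T l * T m) j n + (if l = m then C m n * T i j n else 0)
      + C i j * ((if i = l then T m j n else 0) + if j = n then T l i m else 0) := by
  rw [H.apply_cons_cons, mul_triple (H.singleton i) (H.singleton j), D_apply, D_apply, D_apply,
    D_apply, H.apply_pair, H.apply_pair, H.apply_triple, H.apply_triple, mul_assoc (T i),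
    Matrix.mul_apply]
  simp only [H.apply_four, mul_add, Finset.sum_add_distrib, one_apply, eq_comm (a := l) (b := i),
    eq_comm (a := n) (b := j)]
  by_cases hlm : l = m <;> simp [hlm, mul_comm]

theorem isHermitian (H : IsMeixnerSeries T C h) (hh : IsSelfAdjoint h) (i : Fin d) :
    (T i).IsHermitian := by
  ext j k
  rw [Matrix.conjTranspose_apply, ← H.apply_triple, ← H.apply_triple]
  exact congrFun hh [j, i, k]

/-- Compare the coefficients of `z_j z_i z_l z_m z_j` and of the reversed word. -/
theorem mul_comm_of_isSelfAdjoint (H : IsMeixnerSeries T C h) (hh : IsSelfAdjoint h)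
    (l i m j : Fin d) : T l i m * C m j = C i j * T l i m := by
  have T_star : ∀ i j k, starRingEnd ℂ (T i j k) = T i k j :=
    fun i j k => (H.isHermitian hh i).apply k j
  have mul_star : starRingEnd ℂ ((T m * T l * T i) j j) = (T i * T l * T m) j j := by
    rw [starRingEnd_apply, ← Matrix.conjTranspose_apply, Matrix.conjTranspose_mul,
      Matrix.conjTranspose_mul, (H.isHermitian hh i).eq, (H.isHermitian hh l).eq,
      (H.isHermitian hh m).eq, mul_assoc]
  have h1 : starRingEnd ℂ (h [j, m, l, i, j]) = h [j, i, l, m, j] := congrFun hh [j, i, l, m, j]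
  simp only [H.apply_five, map_add, map_mul, mul_star, apply_ite (starRingEnd ℂ), map_zero,
    Complex.conj_ofReal, T_star, mul_add, mul_ite, mul_zero, if_true, eq_comm (a := l) (b := i),
    eq_comm (a := m) (b := l)] at h1
  linear_combination h1

end IsMeixnerSeries

end NCSeries

/-! ### Functionals and their cumulants -/

namespace NCFunctional

open NCSeries

variable {d : ℕ}

theorem monomial_nil : monomial ([] : List (Fin d)) = 1 := rfl

theorem monomial_append (u v : List (Fin d)) : monomial (u ++ v) = monomial u * monomial v := by
  simp only [monomial, List.map_append, List.prod_append]

theorem ext_monomial {V : Type*} [AddCommMonoid V] [Module ℂ V]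
    {f g : FreeAlgebra ℂ (Fin d) →ₗ[ℂ] V} (h : ∀ u, f (monomial u) = g (monomial u)) :
    f = g := by
  refine (FreeAlgebra.basisFreeMonoid ℂ (Fin d)).ext fun u => ?_
  rw [basis_eq_monomial, h]

theorem one_add_M_apply {φ : NCFunctional d} (hφ : φ 1 = 1) (u : List (Fin d)) :
    (1 + φ.M) u = φ (monomial u) := by
  by_cases hu : u = []
  · rw [hu, NCSeries.add_apply, one_nil, M_nil, add_zero, monomial_nil, hφ]
  · simp [NCSeries.add_apply, one_apply, M, hu]

theorem ofMoments_one (m : NCSeries d) : ofMoments m 1 = 1 := by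
  rw [← monomial_nil, ofMoments_monomial, if_pos rfl]

theorem M_ofMoments {m : NCSeries d} (hm : m [] = 0) : (ofMoments m).M = m := by
  ext u
  by_cases hu : u = []
  · rw [hu, M_nil, hm]
  · simp only [M, hu, if_false, ofMoments_monomial]

theorem isUnit_one_add_M (φ : NCFunctional d) : IsUnit (1 + φ.M) := isUnit_one_add φ.M_nil

theorem one_sub_eta (φ : NCFunctional d) : 1 - φ.eta = Ring.inverse (1 + φ.M) := by
  rw [eta, sub_sub_cancel]

theorem eta_nil (φ : NCFunctional d) : φ.eta [] = 0 := by
  rw [eta, sub_apply, inverse_nil φ.isUnit_one_add_M, one_nil, sub_self]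
  rw [add_apply, M_nil, one_nil, add_zero]

theorem one_sub_eta_mul (φ : NCFunctional d) : (1 - φ.eta) * (1 + φ.M) = 1 := by
  rw [one_sub_eta, Ring.inverse_mul_cancel _ φ.isUnit_one_add_M]

theorem one_add_M_mul (φ : NCFunctional d) : (1 + φ.M) * (1 - φ.eta) = 1 := by
  rw [one_sub_eta, Ring.mul_inverse_cancel _ φ.isUnit_one_add_M]

theorem eta_eq_of_mul {φ : NCFunctional d} {h : NCSeries d} (H : (1 - h) * (1 + φ.M) = 1) :
    φ.eta = h :=
  (sub_right_injective (left_inv_eq_right_inv H φ.one_add_M_mul)).symm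

theorem ext_eta {φ ψ : NCFunctional d} (hφ : φ 1 = 1) (hψ : ψ 1 = 1) (h : φ.eta = ψ.eta) :
    φ = ψ := by
  refine ext_monomial fun u => ?_
  have one_add_M_eq : 1 + φ.M = 1 + ψ.M :=
    left_inv_eq_right_inv φ.one_add_M_mul (h ▸ ψ.one_sub_eta_mul)
  rw [← one_add_M_apply hφ, ← one_add_M_apply hψ, one_add_M_eq]

theorem eta_ofEta {h : NCSeries d} (hh : h [] = 0) : (ofEta h).eta = h := by
  have inverse_sub_one_nil : (Ring.inverse (1 - h) - 1) [] = 0 := by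
    rw [sub_apply, inverse_nil (isUnit_one_sub hh), one_nil, sub_self]
    rw [sub_apply, hh, one_nil, sub_zero]
  apply eta_eq_of_mul
  rw [ofEta, M_ofMoments inverse_sub_one_nil, add_sub_cancel,
    Ring.mul_inverse_cancel _ (isUnit_one_sub hh)]

theorem ofEta_one (h : NCSeries d) : ofEta h 1 = 1 := ofMoments_one _

theorem M_eq_subst (φ : NCFunctional d) : φ.M = subst φ.R (chg φ.M) :=
  (existsUnique_cumulant φ.M φ.M_nil).choose_spec.1

theorem R_eq_of_subst {φ : NCFunctional d} {r : NCSeries d} (h : φ.M = subst r (chg φ.M)) :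
    φ.R = r :=
  ((existsUnique_cumulant φ.M φ.M_nil).choose_spec.2 r h).symm

theorem R_nil (φ : NCFunctional d) : φ.R [] = 0 := by
  rw [← subst_nil (chg_nil φ.M) φ.R, ← M_eq_subst, M_nil]

theorem R_ofR {r : NCSeries d} (hr : r [] = 0) : (ofR r).R = r := by
  have h : momentOfFree r = subst r (chg (momentOfFree r)) :=
    (existsUnique_moment r).choose_spec.1
  apply R_eq_of_subst
  rw [ofR, M_ofMoments, ← h]
  rw [h, subst_nil (chg_nil _), hr]

theorem eta_singleton (φ : NCFunctional d) (i : Fin d) :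
    φ.eta [i] = φ (FreeAlgebra.ι ℂ i) := by
  have h := congrFun (congrArg (D i) φ.one_sub_eta_mul) []
  rw [D_mul, D_sub, D_add, D_one, zero_add, zero_sub, NCSeries.add_apply, mul_nil,
    NCSeries.smul_apply, NCSeries.neg_apply, NCSeries.sub_apply, NCSeries.add_apply, one_nil,
    eta_nil, M_nil, sub_zero, add_zero, one_mul, mul_one, NCSeries.zero_apply, D_apply,
    D_apply, neg_add_eq_zero] at h
  rw [h]
  simp [M, monomial]

/-! ### The transformations `Φ` and `B` -/

theorem eta_Phi (φ ψ : NCFunctional d) :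
    (Phi φ ψ).eta = Ring.inverse (1 + ψ.M) * subst φ.R (chg ψ.M) :=
  eta_ofEta (by rw [mul_nil, subst_nil (chg_nil ψ.M), R_nil, mul_zero])

theorem D_eta_Phi (φ ψ : NCFunctional d) (i : Fin d) :
    D i (Phi φ ψ).eta = subst (D i φ.R) (chg ψ.M) := by
  rw [eta_Phi, D_inverse_mul_subst_chg ψ.M_nil φ.R_nil]

theorem eta_Phi_self (φ : NCFunctional d) : (Phi φ φ).eta = φ.eta := by
  have h := φ.one_sub_eta_mul
  rw [mul_add, mul_one, sub_add_eq_add_sub, sub_eq_iff_eq_add, add_right_inj] at h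
  rw [eta_Phi, ← M_eq_subst, ← one_sub_eta, h]

theorem eta_Phi_singleton (φ ψ : NCFunctional d) (i : Fin d) :
    (Phi φ ψ).eta [i] = φ.R [i] :=
  (congrFun (D_eta_Phi φ ψ i) []).trans (subst_nil (chg_nil ψ.M) (D i φ.R))

theorem D_D_eta_Phi {φ : NCFunctional d} (hφ : ∀ i, φ.R [i] = 0) (ψ : NCFunctional d)
    (i j : Fin d) :
    D i (D j (Phi φ ψ).eta) =
      subst (D i (D j φ.R)) (chg ψ.M) + D i ψ.eta * D j (Phi φ ψ).eta := by
  have h := D_inverse_mul_subst_chg ψ.M_nil (R := D j φ.R) (hφ j) i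
  rw [← D_eta_Phi, ← one_sub_eta, D_mul, D_sub, D_one, NCSeries.sub_apply, one_nil, eta_nil,
    sub_zero, one_smul, zero_sub, neg_mul, neg_add_eq_sub] at h
  exact sub_eq_iff_eq_add.1 h

theorem isMeixnerSeries_eta_Phi_iff {φ ψ : NCFunctional d} {s : ℝ} {a : Fin d → ℝ}
    (hψ : ∀ i, D i ψ.eta = (s : ℂ) • D i (Phi φ ψ).eta + (a i : ℂ) • 1)
    {T : Fin d → Matrix (Fin d) (Fin d) ℂ} {C : Matrix (Fin d) (Fin d) ℝ} :
    IsMeixnerSeries (fun i => (a i : ℂ) • (1 : Matrix (Fin d) (Fin d) ℂ) + T i)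
        (Matrix.of fun i j => s + C i j) (Phi φ ψ).eta ↔
      IsMeixnerSeries T C φ.R := by
  have subst_rhs : ∀ i j, subst ((if i = j then 1 else 0) + ∑ k, T i j k • D k φ.R
        + (C i j : ℂ) • (D i φ.R * D j φ.R)) (chg ψ.M) + D i ψ.eta * D j (Phi φ ψ).eta =
      (if i = j then 1 else 0)
        + ∑ k, ((a i : ℂ) • (1 : Matrix (Fin d) (Fin d) ℂ) + T i) j k • D k (Phi φ ψ).eta
        + ((s + C i j : ℝ) : ℂ) • (D i (Phi φ ψ).eta * D j (Phi φ ψ).eta) := by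
    intro i j
    simp only [← substAlgHom_apply (chg_nil ψ.M), map_add, map_sum, map_smul, map_mul,
      apply_ite (substAlgHom (chg_nil ψ.M)), map_one, map_zero]
    simp only [substAlgHom_apply, ← D_eta_Phi, hψ, add_mul, smul_mul_assoc, one_mul,
      Matrix.add_apply, Matrix.smul_apply, Matrix.one_apply, add_smul,
      Finset.sum_add_distrib, smul_eq_mul, mul_ite, mul_one, mul_zero, ite_smul, zero_smul,
      Finset.sum_ite_eq, Finset.mem_univ, if_true, Complex.ofReal_add]
    abel
  constructor
  · intro h
    have singleton : ∀ i, φ.R [i] = 0 := fun i => by rw [← eta_Phi_singleton φ ψ, h.singleton]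
    refine ⟨φ.R_nil, singleton, fun i j => subst_chg_injective ψ.M_nil ?_⟩
    refine add_right_cancel (b := D i ψ.eta * D j (Phi φ ψ).eta) ?_
    simp only [subst_rhs, ← D_D_eta_Phi singleton]
    exact h.quadratic i j
  · intro h
    refine ⟨eta_nil _, fun i => by rw [eta_Phi_singleton, h.singleton], fun i j => ?_⟩
    rw [D_D_eta_Phi h.singleton, h.quadratic]
    exact subst_rhs i j

theorem isMeixnerSeries_eta_iff {φ : NCFunctional d} {T : Fin d → Matrix (Fin d) (Fin d) ℂ}
    {C : Matrix (Fin d) (Fin d) ℝ} :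
    IsMeixnerSeries T (Matrix.of fun i j => 1 + C i j) φ.eta ↔ IsMeixnerSeries T C φ.R := by
  have h := isMeixnerSeries_eta_Phi_iff (φ := φ) (ψ := φ) (s := 1) (a := 0) (T := T) (C := C)
    fun i => by simp [eta_Phi_self]
  simpa [eta_Phi_self] using h

theorem sum_smul_X_nil (a : Fin d → ℂ) : (∑ i, a i • X i : NCSeries d) [] = 0 := by
  simp only [NCSeries.sum_apply, NCSeries.smul_apply, X_nil, mul_zero, Finset.sum_const_zero]

theorem D_sum_smul_X (a : Fin d → ℂ) (i : Fin d) :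
    D i (∑ j, a j • X j : NCSeries d) = a i • 1 := by
  simp only [D_sum, D_smul, D_X, smul_ite, smul_zero, Finset.sum_ite_eq, Finset.mem_univ, if_true]

theorem eta_delta (a : Fin d → ℝ) : (delta a).eta = ∑ i, (a i : ℂ) • X i := by
  apply eta_eq_of_mul
  have delta_one : delta a 1 = 1 := map_one (FreeAlgebra.lift ℂ fun i => (a i : ℂ))
  apply ext_D
  · rw [mul_nil, sub_apply, sum_smul_X_nil, NCSeries.add_apply, M_nil, one_nil, sub_zero,
      add_zero, one_mul]
  · intro i
    ext w
    rw [D_mul, D_sub, D_one, D_sum_smul_X, sub_apply, sum_smul_X_nil, one_nil, sub_zero,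
      one_smul, zero_sub, neg_mul, smul_mul_assoc, one_mul, NCSeries.add_apply,
      NCSeries.neg_apply, NCSeries.smul_apply, D_apply, one_add_M_apply delta_one,
      one_add_M_apply delta_one]
    simp [delta, monomial, NCSeries.zero_apply]

theorem R_delta (a : Fin d → ℝ) : (delta a).R = ∑ i, (a i : ℂ) • X i := by
  apply R_eq_of_subst
  have h := (delta a).one_add_M_mul
  rw [eta_delta, mul_sub, mul_one, sub_eq_iff_eq_add, add_right_inj] at h
  rw [← substAlgHom_apply (chg_nil (delta a).M)]
  simp only [map_sum, map_smul, substAlgHom_X, chg, ← mul_smul_comm, ← Finset.mul_sum]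
  exact h

theorem R_boxpow_boxplus_delta (φ : NCFunctional d) (s : ℝ) (a : Fin d → ℝ) :
    ((φ.boxpow s).boxplus (delta a)).R = (s : ℂ) • φ.R + ∑ i, (a i : ℂ) • X i := by
  have smul_R_nil : ((s : ℂ) • φ.R) [] = 0 := by rw [NCSeries.smul_apply, R_nil, mul_zero]
  rw [boxplus, R_ofR, boxpow, R_ofR smul_R_nil, R_delta]
  rw [NCSeries.add_apply, R_nil, R_nil, add_zero]

theorem eta_boxpow_boxplus_delta (φ : NCFunctional d) (s : ℝ) (a : Fin d → ℝ) :
    ((φ.boxpow s).boxplus (delta a)).eta =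
      (s : ℂ) • (Phi φ ((φ.boxpow s).boxplus (delta a))).eta + ∑ i, (a i : ℂ) • X i := by
  set ψ := (φ.boxpow s).boxplus (delta a) with hψ
  apply ext_D
  · rw [NCSeries.add_apply, NCSeries.smul_apply, eta_nil, eta_nil, sum_smul_X_nil, mul_zero,
      add_zero]
  · intro i
    rw [← eta_Phi_self ψ, D_eta_Phi ψ ψ, hψ, R_boxpow_boxplus_delta, ← hψ, D_add, D_add,
      D_smul, D_smul, D_sum_smul_X, D_eta_Phi, ← substAlgHom_apply (chg_nil ψ.M), map_add,
      map_smul, map_smul, map_one, substAlgHom_apply]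

theorem BT_eq_Phi (φ : NCFunctional d) (a : Fin d → ℝ) {t : ℝ} (ht : t ≠ -1) :
    BT a t φ = Phi φ ((φ.boxpow (1 + t)).boxplus (delta a)) := by
  have one_add_ne_zero : 1 + t ≠ 0 := fun h => ht (by linarith)
  have smul_eta_nil : ∀ (c : ℂ) (ψ : NCFunctional d), (c • ψ.eta) [] = 0 := fun c ψ => by
    rw [NCSeries.smul_apply, eta_nil, mul_zero]
  refine ext_eta (ofEta_one _) (ofEta_one _) ?_
  rw [BT, upow, eta_ofEta (smul_eta_nil _ _), uplus, eta_ofEta, eta_delta,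
    eta_boxpow_boxplus_delta]
  · simp only [Pi.neg_apply, Complex.ofReal_neg, neg_smul, Finset.sum_neg_distrib]
    rw [add_neg_cancel_right, smul_smul, ← Complex.ofReal_mul,
      one_div_mul_cancel one_add_ne_zero, Complex.ofReal_one, one_smul]
  · rw [NCSeries.add_apply, eta_nil, eta_nil, add_zero]

theorem isMeixnerSeries_eta_Phi {φ : NCFunctional d} {T : Fin d → Matrix (Fin d) (Fin d) ℂ}
    {C : Matrix (Fin d) (Fin d) ℝ} (h : IsMeixnerSeries T C φ.R) (a : Fin d → ℝ) (t : ℝ) :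
    IsMeixnerSeries (fun i => (a i : ℂ) • (1 : Matrix (Fin d) (Fin d) ℂ) + T i)
      (Matrix.of fun i j => 1 + (t + C i j))
      (Phi φ ((φ.boxpow (1 + t)).boxplus (delta a))).eta := by
  simp only [← add_assoc]
  refine (isMeixnerSeries_eta_Phi_iff fun i => ?_).2 h
  conv_lhs => rw [eta_boxpow_boxplus_delta, D_add, D_smul, D_sum_smul_X]

end NCFunctional

/-! ### States from symmetric operators -/

namespace NCFunctional

open NCSeries

variable {d : ℕ}

theorem adj_add (P Q : FreeAlgebra ℂ (Fin d)) : adj (P + Q) = adj P + adj Q := by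
  rw [adj, map_add, Finsupp.sum_add_index']
  · rfl
  · simp
  · intro u c c'
    rw [map_add, add_smul]

theorem adj_smul (c : ℂ) (P : FreeAlgebra ℂ (Fin d)) :
    adj (c • P) = starRingEnd ℂ c • adj P := by
  rw [adj, map_smul, Finsupp.sum_smul_index' (by simp), adj, Finsupp.smul_sum]
  simp only [smul_eq_mul, map_mul, mul_smul]

theorem adj_monomial (u : List (Fin d)) : adj (monomial u) = monomial u.reverse := by
  have h := basis_eq_monomial (FreeMonoid.ofList u)
  rw [FreeMonoid.toList_ofList] at h
  rw [← h, adj, Module.Basis.repr_self, Finsupp.sum_single_index (by simp), map_one, one_smul,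
    FreeMonoid.toList_ofList]

theorem monomial_induction {p : FreeAlgebra ℂ (Fin d) → Prop} (mono : ∀ u, p (monomial u))
    (add : ∀ P Q, p P → p Q → p (P + Q)) (smul : ∀ (c : ℂ) P, p P → p (c • P))
    (P : FreeAlgebra ℂ (Fin d)) : p P := by
  have mem_span : P ∈ Submodule.span ℂ (Set.range (FreeAlgebra.basisFreeMonoid ℂ (Fin d))) := by
    rw [Module.Basis.span_eq]
    trivial
  induction mem_span using Submodule.span_induction with
  | mem x hx =>
    obtain ⟨u, rfl⟩ := hx
    rw [basis_eq_monomial]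
    exact mono _
  | zero => simpa only [zero_smul] using smul 0 _ (mono [])
  | add x y _ _ hx hy => exact add x y hx hy
  | smul c x _ hx => exact smul c x hx

section SymmetricOperators

variable {V : Type*} [AddCommGroup V] [Module ℂ V] {B : V →ₗ⋆[ℂ] V →ₗ[ℂ] ℂ}
  {X : Fin d → Module.End ℂ V} (hX : ∀ i x y, B (X i x) y = B x (X i y))
include hX

theorem lift_adj_apply (P : FreeAlgebra ℂ (Fin d)) (x y : V) :
    B (FreeAlgebra.lift ℂ X (adj P) x) y = B x (FreeAlgebra.lift ℂ X P y) := by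
  induction P using monomial_induction with
  | mono u =>
    rw [adj_monomial]
    induction u generalizing x with
    | nil => rw [List.reverse_nil, monomial_nil, map_one, Module.End.one_apply,
        Module.End.one_apply]
    | cons i u ih =>
      have lift_singleton : FreeAlgebra.lift ℂ X (monomial [i]) = X i := by simp [monomial]
      rw [List.reverse_cons, monomial_append, map_mul, Module.End.mul_apply, ih, lift_singleton,
        hX, ← List.singleton_append, monomial_append, map_mul, Module.End.mul_apply,
        lift_singleton]
  | add P Q hP hQ => simp only [adj_add, map_add, LinearMap.add_apply, hP, hQ]
  | smul c P hP =>
    simp only [adj_smul, map_smul, LinearMap.smul_apply, LinearMap.map_smulₛₗ, Complex.conj_conj,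
      hP]

theorem isState_of_symmetric (hB : B.IsSymm) (hB0 : ∀ x, 0 ≤ (B x x).re) {v : V}
    (hv : B v v = 1) {φ : NCFunctional d} (hφ : ∀ P, φ P = B v (FreeAlgebra.lift ℂ X P v)) :
    IsState φ where
  unital := by rw [hφ, map_one, Module.End.one_apply, hv]
  star_compat P := by rw [hφ, hφ, ← lift_adj_apply hX P, hB.eq]
  nonneg P := by
    rw [hφ, map_mul, Module.End.mul_apply, ← Complex.conj_re, hB.eq, lift_adj_apply hX]
    exact hB0 _

end SymmetricOperators

end NCFunctional

/-! ### The Fock space -/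

section WeightedForm

variable {ι : Type*}

/-- The sesquilinear form `⟨f, g⟩ = ∑_u w_u \overline{f_u} g_u` on finitely supported families:
the basis vectors are orthogonal with squared norms `w_u`. -/
noncomputable def weightedForm (w : ι → ℝ) : (ι →₀ ℂ) →ₗ⋆[ℂ] (ι →₀ ℂ) →ₗ[ℂ] ℂ :=
  Finsupp.lsum ℕ fun u =>
    (LinearMap.toSpanSingleton ℂ _ ((w u : ℂ) • Finsupp.lapply u)).comp
      (starRingEnd ℂ).toSemilinearMap

theorem weightedForm_single_left (w : ι → ℝ) (u : ι) (c : ℂ) (g : ι →₀ ℂ) :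
    weightedForm w (Finsupp.single u c) g = starRingEnd ℂ c * (w u * g u) := by
  simp [weightedForm]

theorem weightedForm_isSymm (w : ι → ℝ) : (weightedForm w).IsSymm where
  eq f g := by
    induction f using Finsupp.induction_linear with
    | zero => simp
    | add f f' hf hf' => simp only [map_add, LinearMap.add_apply, hf, hf']
    | single u a =>
      induction g using Finsupp.induction_linear with
      | zero => simp
      | add g g' hg hg' => simp only [map_add, LinearMap.add_apply, hg, hg']
      | single v b =>
        rw [weightedForm_single_left, weightedForm_single_left]
        by_cases huv : u = v
        · subst huv
          simp [mul_comm, mul_assoc]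
        · simp [huv, Ne.symm huv]

theorem weightedForm_self_nonneg {w : ι → ℝ} (hw : ∀ u, 0 ≤ w u) (f : ι →₀ ℂ) :
    0 ≤ (weightedForm w f f).re := by
  have weightedForm_self : weightedForm w f f =
      ((∑ u ∈ f.support, w u * Complex.normSq (f u) : ℝ) : ℂ) := by
    nth_rewrite 1 [← f.sum_single]
    simp only [Finsupp.sum, map_sum, LinearMap.sum_apply, weightedForm_single_left,
      Complex.ofReal_sum, Complex.ofReal_mul, Complex.normSq_eq_conj_mul_self, mul_left_comm]
  rw [weightedForm_self, Complex.ofReal_re]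
  exact Finset.sum_nonneg fun u _ => mul_nonneg (hw u) (Complex.normSq_nonneg _)

theorem weightedForm_adjoint {w : ι → ℝ} {A A' : Module.End ℂ (ι →₀ ℂ)}
    (h : ∀ u v, starRingEnd ℂ (A (Finsupp.single u 1) v) * w v = w u * A' (Finsupp.single v 1) u)
    (f g : ι →₀ ℂ) : weightedForm w (A f) g = weightedForm w f (A' g) := by
  suffices (weightedForm w).comp A = (weightedForm w).compl₂ A' by
    exact congrFun (congrArg (⇑) (LinearMap.congr_fun this f)) g
  refine Finsupp.lhom_ext' fun u => LinearMap.ext_ring (Finsupp.lhom_ext' fun v =>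
    LinearMap.ext_ring ?_)
  simp only [LinearMap.comp_apply, LinearMap.compl₂_apply, Finsupp.lsingle_apply,
    weightedForm_single_left, map_one, one_mul, ← h]
  rw [← (weightedForm_isSymm w).eq, weightedForm_single_left]
  simp [mul_comm]

end WeightedForm

namespace Fock

open NCSeries

variable {d : ℕ}

/-- The number by which the squared norm is multiplied when the letter `j` is put in front of a
word: `K_{jk}` if the first letter of the word is `k`. -/
def stepWeight (K : Matrix (Fin d) (Fin d) ℝ) (j : Fin d) : List (Fin d) → ℝ
  | [] => 1
  | k :: _ => K j k

/-- The squared norm of the basis vector `e_v = e_{v(1)} ⊗ ⋯ ⊗ e_{v(n)}` of the Fock space. -/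
def weight (K : Matrix (Fin d) (Fin d) ℝ) : List (Fin d) → ℝ
  | [] => 1
  | j :: v => stepWeight K j v * weight K v

/-- The creation operator `e_v ↦ e_i ⊗ e_v`. -/
noncomputable def creation (i : Fin d) : Module.End ℂ (List (Fin d) →₀ ℂ) :=
  Finsupp.lmapDomain ℂ ℂ (i :: ·)

/-- The operator that applies the matrix `A` to the first tensor factor. -/
noncomputable def gauge (A : Matrix (Fin d) (Fin d) ℂ) : Module.End ℂ (List (Fin d) →₀ ℂ) :=
  Finsupp.linearCombination ℂ fun
    | [] => 0
    | l :: v => ∑ k, Finsupp.single (k :: v) (A k l)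

/-- The annihilation operator, adjoint to `creation i` for the squared norms `weight K`. -/
noncomputable def annihilation (K : Matrix (Fin d) (Fin d) ℝ) (i : Fin d) :
    Module.End ℂ (List (Fin d) →₀ ℂ) :=
  Finsupp.linearCombination ℂ fun
    | [] => 0
    | j :: v => if i = j then Finsupp.single v (stepWeight K i v : ℂ) else 0

theorem weight_nonneg {K : Matrix (Fin d) (Fin d) ℝ} (hK : ∀ i j, 0 ≤ K i j)
    (v : List (Fin d)) : 0 ≤ weight K v := by
  induction v with
  | nil => exact zero_le_one
  | cons j v ih =>
    refine mul_nonneg ?_ ih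
    cases v with
    | nil => exact zero_le_one
    | cons k v => exact hK j k

theorem creation_apply_nil (i : Fin d) (f : List (Fin d) →₀ ℂ) : creation i f [] = 0 :=
  Finsupp.mapDomain_of_notMem_range f _ fun ⟨_, h⟩ => List.cons_ne_nil _ _ h

theorem creation_apply_cons (i j : Fin d) (f : List (Fin d) →₀ ℂ) (v : List (Fin d)) :
    creation i f (j :: v) = if i = j then f v else 0 := by
  split_ifs with hij
  · subst hij
    exact Finsupp.mapDomain_apply List.cons_injective f v
  · exact Finsupp.mapDomain_of_notMem_range f _ fun ⟨_, h⟩ => hij (List.cons.inj h).1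

theorem gauge_apply_nil (A : Matrix (Fin d) (Fin d) ℂ) (f : List (Fin d) →₀ ℂ) :
    gauge A f [] = 0 := by
  induction f using Finsupp.induction_linear with
  | zero => simp
  | add f g hf hg => rw [map_add, Finsupp.add_apply, hf, hg, add_zero]
  | single u c => cases u <;> simp [gauge]

theorem gauge_apply_cons (A : Matrix (Fin d) (Fin d) ℂ) (f : List (Fin d) →₀ ℂ) (j : Fin d)
    (v : List (Fin d)) : gauge A f (j :: v) = ∑ k, A j k * f (k :: v) := by
  induction f using Finsupp.induction_linear with
  | zero => simp
  | add f g hf hg =>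
    simp only [map_add, Finsupp.add_apply, hf, hg, mul_add, Finset.sum_add_distrib]
  | single u c =>
    rcases u with _ | ⟨l, u⟩
    · simp [gauge]
    · by_cases huv : u = v <;>
        simp [gauge, Finsupp.single_apply, huv, mul_comm]

theorem annihilation_apply (K : Matrix (Fin d) (Fin d) ℝ) (i : Fin d) (f : List (Fin d) →₀ ℂ)
    (v : List (Fin d)) : annihilation K i f v = stepWeight K i v * f (i :: v) := by
  induction f using Finsupp.induction_linear with
  | zero => simp
  | add f g hf hg => rw [map_add, Finsupp.add_apply, hf, hg, Finsupp.add_apply, mul_add]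
  | single u c =>
    rcases u with _ | ⟨j, u⟩
    · simp [annihilation]
    · by_cases hij : i = j
      · by_cases huv : u = v <;> simp [annihilation, hij, huv, mul_comm]
      · simp [annihilation, hij]

variable {T : Fin d → Matrix (Fin d) (Fin d) ℂ} {K : Matrix (Fin d) (Fin d) ℝ}

theorem weightedForm_creation (i : Fin d) (f g : List (Fin d) →₀ ℂ) :
    weightedForm (weight K) (creation i f) g = weightedForm (weight K) f (annihilation K i g) := by
  refine weightedForm_adjoint (fun u v => ?_) f g
  rw [annihilation_apply, creation, Finsupp.lmapDomain_apply, Finsupp.mapDomain_single]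
  by_cases huv : i :: u = v
  · subst huv
    simp [weight, mul_comm]
  · simp [huv, Ne.symm huv]

theorem weightedForm_annihilation (i : Fin d) (f g : List (Fin d) →₀ ℂ) :
    weightedForm (weight K) (annihilation K i f) g = weightedForm (weight K) f (creation i g) := by
  rw [← (weightedForm_isSymm _).eq, ← weightedForm_creation, (weightedForm_isSymm _).eq]

theorem weightedForm_gauge {A : Matrix (Fin d) (Fin d) ℂ} (hA : A.IsHermitian)
    (hAK : ∀ j l k, A j l * K l k = K j k * A j l) (f g : List (Fin d) →₀ ℂ) :
    weightedForm (weight K) (gauge A f) g = weightedForm (weight K) f (gauge A g) := by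
  have mul_stepWeight : ∀ j l v, A j l * stepWeight K l v = stepWeight K j v * A j l := by
    rintro j l (_ | ⟨k, _⟩)
    · simp only [stepWeight, Complex.ofReal_one, mul_one, one_mul]
    · exact hAK j l k
  have gauge_single : ∀ j l (u v : List (Fin d)),
      gauge A (Finsupp.single (l :: u) 1) (j :: v) = if u = v then A j l else 0 := by
    intro j l u v
    by_cases huv : u = v <;> simp [gauge_apply_cons, Finsupp.single_apply, huv]
  refine weightedForm_adjoint (fun u v => ?_) f g
  rcases u with _ | ⟨l, u⟩ <;> rcases v with _ | ⟨j, v⟩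
  · simp only [gauge_apply_nil, map_zero, zero_mul, mul_zero]
  · simp [gauge_apply_nil, gauge_apply_cons]
  · simp [gauge_apply_nil, gauge_apply_cons]
  · rw [gauge_single, gauge_single]
    by_cases huv : u = v
    · subst huv
      have star_apply : starRingEnd ℂ (A j l) = A l j := hA.apply l j
      simp only [if_true, star_apply, weight, Complex.ofReal_mul]
      linear_combination (weight K u : ℂ) * mul_stepWeight l j u
    · simp [huv, Ne.symm huv]

/-- The operator `X_i = a_i^+ + T_i + a_i^-`. -/
noncomputable def position (T : Fin d → Matrix (Fin d) (Fin d) ℂ)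
    (K : Matrix (Fin d) (Fin d) ℝ) (i : Fin d) : Module.End ℂ (List (Fin d) →₀ ℂ) :=
  creation i + gauge (T i) + annihilation K i

theorem weightedForm_position (hT : ∀ i, (T i).IsHermitian)
    (hTK : ∀ i j l k, T i j l * K l k = K j k * T i j l) (i : Fin d)
    (f g : List (Fin d) →₀ ℂ) :
    weightedForm (weight K) (position T K i f) g =
      weightedForm (weight K) f (position T K i g) := by
  simp only [position, LinearMap.add_apply, map_add, weightedForm_creation,
    weightedForm_annihilation, weightedForm_gauge (hT i) (hTK i)]
  ring

theorem position_apply_nil (i : Fin d) (f : List (Fin d) →₀ ℂ) : position T K i f [] = f [i] := by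
  simp [position, creation_apply_nil, gauge_apply_nil, annihilation_apply, stepWeight]

theorem position_apply_cons (i j : Fin d) (f : List (Fin d) →₀ ℂ) (v : List (Fin d)) :
    position T K i f (j :: v) = (if i = j then f v else 0) + ∑ k, T i j k * f (k :: v)
      + K i j * f (i :: j :: v) := by
  simp [position, creation_apply_cons, gauge_apply_cons, annihilation_apply, stepWeight]

end Fock

namespace NCFunctional

open NCSeries Fock

variable {d : ℕ} {T : Fin d → Matrix (Fin d) (Fin d) ℂ} {K : Matrix (Fin d) (Fin d) ℝ}

/-- The generating series, in words `s`, of the coefficients at `e_v` of the vectors `X_s Ω`. -/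
noncomputable def vacuumSeries (φ : NCFunctional d) (v : List (Fin d)) : NCSeries d :=
  (v.map fun j => D j φ.eta).prod * (1 + φ.M)

theorem D_vacuumSeries_nil (φ : NCFunctional d) (i : Fin d) :
    D i (φ.vacuumSeries []) = φ.vacuumSeries [i] := by
  have h := congrArg (D i) φ.one_sub_eta_mul
  rw [D_mul, D_sub, D_one, zero_sub, sub_apply, one_nil, eta_nil, sub_zero, one_smul, neg_mul,
    neg_add_eq_zero] at h
  simp only [vacuumSeries, List.map_nil, List.prod_nil, one_mul, List.map_cons, List.prod_cons,
    mul_one]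
  exact h.symm

theorem D_vacuumSeries_cons {φ : NCFunctional d} (h : IsMeixnerSeries T K φ.eta) (i j : Fin d)
    (v : List (Fin d)) :
    D i (φ.vacuumSeries (j :: v)) = (if i = j then φ.vacuumSeries v else 0)
      + ∑ k, T i j k • φ.vacuumSeries (k :: v) + (K i j : ℂ) • φ.vacuumSeries (i :: j :: v) := by
  simp only [vacuumSeries, List.map_cons, List.prod_cons, mul_assoc]
  rw [D_mul, D_apply j, h.singleton, zero_smul, add_zero, h.quadratic, add_mul, add_mul,
    Finset.sum_mul]
  simp only [smul_mul_assoc, ite_mul, one_mul, zero_mul, mul_assoc]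

theorem vacuumSeries_apply_nil {φ : NCFunctional d} (h : IsMeixnerSeries T K φ.eta)
    (v : List (Fin d)) : φ.vacuumSeries v [] = Finsupp.single ([] : List (Fin d)) (1 : ℂ) v := by
  cases v with
  | nil => simp [vacuumSeries, NCSeries.add_apply, one_nil, M_nil]
  | cons j v =>
    rw [vacuumSeries, List.map_cons, List.prod_cons, mul_assoc, mul_nil, D_apply, h.singleton,
      zero_mul, Finsupp.single_eq_of_ne (List.cons_ne_nil j v)]

theorem lift_position_monomial_apply {φ : NCFunctional d} (h : IsMeixnerSeries T K φ.eta)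
    (s v : List (Fin d)) :
    FreeAlgebra.lift ℂ (position T K) (monomial s) (Finsupp.single [] 1) v =
      φ.vacuumSeries v s := by
  induction s generalizing v with
  | nil => rw [monomial_nil, map_one, Module.End.one_apply, vacuumSeries_apply_nil h]
  | cons i s ih =>
    have lift_cons : FreeAlgebra.lift ℂ (position T K) (monomial (i :: s)) =
        position T K i * FreeAlgebra.lift ℂ (position T K) (monomial s) := by simp [monomial]
    rw [lift_cons, Module.End.mul_apply]
    change _ = D i (φ.vacuumSeries v) s
    cases v with
    | nil => rw [position_apply_nil, ih, D_vacuumSeries_nil]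
    | cons j v =>
      rw [position_apply_cons, D_vacuumSeries_cons h]
      simp only [ih, NCSeries.add_apply, NCSeries.smul_apply, NCSeries.sum_apply]
      congr 2
      split_ifs <;> rfl

theorem apply_eq_vacuum {φ : NCFunctional d} (hφ : φ 1 = 1) (h : IsMeixnerSeries T K φ.eta)
    (P : FreeAlgebra ℂ (Fin d)) :
    φ P = weightedForm (weight K) (Finsupp.single [] 1)
      (FreeAlgebra.lift ℂ (position T K) P (Finsupp.single [] 1)) := by
  induction P using monomial_induction with
  | mono u =>
    rw [weightedForm_single_left, lift_position_monomial_apply h, vacuumSeries, List.map_nil,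
      List.prod_nil, one_mul, one_add_M_apply hφ, map_one, one_mul, weight, Complex.ofReal_one,
      one_mul]
  | add P Q hP hQ => simp only [map_add, LinearMap.add_apply, hP, hQ]
  | smul c P hP => simp only [map_smul, LinearMap.smul_apply, hP]

theorem isState_of_isMeixnerSeries_eta (hT : ∀ i, (T i).IsHermitian) (hK : ∀ i j, 0 ≤ K i j)
    (hTK : ∀ i j l k, T i j l * K l k = K j k * T i j l) {φ : NCFunctional d} (hφ : φ 1 = 1)
    (h : IsMeixnerSeries T K φ.eta) : IsState φ :=
  isState_of_symmetric (weightedForm_position hT hTK) (weightedForm_isSymm _)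
    (weightedForm_self_nonneg (weight_nonneg hK))
    (by simp [weightedForm_single_left, weight]) (apply_eq_vacuum hφ h)

theorem isSelfAdjoint_eta {φ : NCFunctional d} (hφ : IsState φ) : IsSelfAdjoint φ.eta := by
  have isSelfAdjoint_one_add_M : IsSelfAdjoint (1 + φ.M) := by
    ext u
    rw [star_apply, one_add_M_apply hφ.unital, one_add_M_apply hφ.unital, ← hφ.star_compat,
      adj_monomial, List.reverse_reverse]
  rw [eta]
  refine (IsSelfAdjoint.one _).sub ?_
  rw [IsSelfAdjoint, ← Ring.inverse_star, isSelfAdjoint_one_add_M.star_eq]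

variable {C : Matrix (Fin d) (Fin d) ℝ}

theorem isFreeMeixnerState_iff {φ : NCFunctional d} :
    IsFreeMeixnerState T C φ ↔ IsState φ ∧ IsMeixnerSeries T C φ.R := by
  have mean_eq (i : Fin d) : φ.R [i] = φ (FreeAlgebra.ι ℂ i) := by
    rw [← eta_singleton, ← eta_Phi_self, eta_Phi_singleton]
  constructor
  · exact fun h => ⟨h.isState, φ.R_nil, fun i => (mean_eq i).trans (h.mean_zero i), h.quadratic⟩
  · exact fun ⟨hφ, h⟩ => ⟨hφ, fun i => (mean_eq i).symm.trans (h.singleton i), h.quadratic⟩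

theorem isState_of_isMeixnerSeries (hT : ∀ i, (T i).IsHermitian) (hC : ∀ i j, -1 ≤ C i j)
    (hTC : ∀ i j l k, T i j l * C l k = C j k * T i j l) {φ : NCFunctional d} (hφ : φ 1 = 1)
    (h : IsMeixnerSeries T C φ.R) : IsState φ := by
  refine isState_of_isMeixnerSeries_eta hT (fun i j => ?_) (fun i j l k => ?_) hφ
    (isMeixnerSeries_eta_iff.2 h)
  · exact neg_le_iff_add_nonneg'.1 (hC i j)
  · simp only [Matrix.of_apply, Complex.ofReal_add, Complex.ofReal_one]
    linear_combination hTC i j l k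

theorem eq_of_isMeixnerSeries {φ ψ : NCFunctional d} (hφ : φ 1 = 1) (hψ : ψ 1 = 1)
    (hφR : IsMeixnerSeries T C φ.R) (hψR : IsMeixnerSeries T C ψ.R) : φ = ψ :=
  ext_eta hφ hψ ((existsUnique_isMeixnerSeries T _).unique
    (isMeixnerSeries_eta_iff.2 hφR) (isMeixnerSeries_eta_iff.2 hψR))

theorem existsUnique_isFreeMeixnerState (hT : ∀ i, (T i).IsHermitian) (hC : ∀ i j, -1 ≤ C i j)
    (hTC : ∀ i j l k, T i j l * C l k = C j k * T i j l) :
    ∃! φ, IsFreeMeixnerState T C φ := by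
  obtain ⟨h, hh, -⟩ := existsUnique_isMeixnerSeries T C
  rw [← R_ofR hh.nil] at hh
  have hstate := isState_of_isMeixnerSeries hT hC hTC (ofMoments_one _) hh
  refine ⟨ofR h, isFreeMeixnerState_iff.2 ⟨hstate, hh⟩, fun ψ hψ => ?_⟩
  obtain ⟨hψ1, hψR⟩ := isFreeMeixnerState_iff.1 hψ
  exact eq_of_isMeixnerSeries hψ1.unital hstate.unital hψR hh

open scoped Kronecker in
theorem mul_comm_of_commute_kronecker {A : Matrix (Fin d) (Fin d) ℂ} {c : Matrix (Fin d) (Fin d) ℂ}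
    (h : Commute (A ⊗ₖ (1 : Matrix (Fin d) (Fin d) ℂ))
      (Matrix.diagonal fun p : Fin d × Fin d => c p.1 p.2)) (j l k : Fin d) :
    A j l * c l k = c j k * A j l := by
  have := congrFun (congrFun h.eq (j, k)) (l, k)
  simpa [Matrix.mul_diagonal, Matrix.diagonal_mul] using this

theorem isFreeMeixnerState_Phi {a : Fin d → ℝ} {t : ℝ} (hC : ∀ i j, -1 ≤ t + C i j)
    {φ : NCFunctional d} (hφ : IsFreeMeixnerState T C φ) :
    IsFreeMeixnerState (fun i => (a i : ℂ) • (1 : Matrix (Fin d) (Fin d) ℂ) + T i)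
      (Matrix.of fun i j => t + C i j) (Phi φ ((φ.boxpow (1 + t)).boxplus (delta a))) := by
  obtain ⟨hstate, hR⟩ := isFreeMeixnerState_iff.1 hφ
  have heta := isMeixnerSeries_eta_iff.2 hR
  have h_sa := isSelfAdjoint_eta hstate
  have hΦ := isMeixnerSeries_eta_iff.1 (isMeixnerSeries_eta_Phi hR a t)
  refine isFreeMeixnerState_iff.2
    ⟨isState_of_isMeixnerSeries (fun i => ?_) hC (fun i j l k => ?_) (ofEta_one _) hΦ, hΦ⟩
  · refine Matrix.IsHermitian.add ?_ (heta.isHermitian h_sa i)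
    rw [Matrix.IsHermitian, Matrix.conjTranspose_smul, Matrix.conjTranspose_one]
    simp
  · have h := heta.mul_comm_of_isSelfAdjoint h_sa i j l k
    simp only [Matrix.of_apply, Complex.ofReal_add, Complex.ofReal_one, Matrix.add_apply,
      Matrix.smul_apply, Matrix.one_apply] at h ⊢
    split_ifs with hjl
    · subst hjl; ring
    · linear_combination h

end NCFunctional

/-! ### Spectral measures and moment problems -/

theorem exists_measure_of_positive {X : Type*} [TopologicalSpace X] [CompactSpace X] [T2Space X]
    [MeasurableSpace X] [BorelSpace X] (L : C(X, ℝ) →ₗ[ℝ] ℝ) (hL : ∀ f, 0 ≤ f → 0 ≤ L f) :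
    ∃ μ : Measure X, ∀ f : C(X, ℝ), ∫ x, f x ∂μ = L f := by
  let Λ : CompactlySupportedContinuousMap X ℝ →ₚ[ℝ] ℝ :=
    PositiveLinearMap.mk₀
      { toFun := fun f => L f.toContinuousMap
        map_add' := fun f g => map_add L f.toContinuousMap g.toContinuousMap
        map_smul' := fun c f => map_smul L c f.toContinuousMap }
      fun f hf => hL f.toContinuousMap hf
  exact ⟨RealRMK.rieszMeasure Λ, fun f =>
    RealRMK.integral_rieszMeasure Λ (CompactlySupportedContinuousMap.continuousMapEquiv f)⟩

section SpectralMeasure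

variable {E : Type*} [NormedAddCommGroup E] [InnerProductSpace ℂ E] [CompleteSpace E]
  {J : E →L[ℂ] E}

theorem exists_measure_spectrum (hJ : IsSelfAdjoint J) (e : E) :
    ∃ μ : Measure (spectrum ℝ J), ∀ f : C(spectrum ℝ J, ℝ),
      ∫ x, f x ∂μ = (inner ℂ e (cfcHom hJ f e)).re := by
  refine exists_measure_of_positive
    { toFun := fun f => (inner ℂ e (cfcHom hJ f e)).re
      map_add' := fun f g => by
        rw [map_add, add_apply, inner_add_right, Complex.add_re]
      map_smul' := fun c f => by
        rw [map_smul, smul_apply, inner_smul_right_eq_smul, Complex.smul_re, RingHom.id_apply] }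
    fun f hf => ?_
  have hpos : 0 ≤ cfcHom hJ f := (cfcHom_nonneg_iff hJ).2 hf
  exact ((ContinuousLinearMap.nonneg_iff_isPositive _).1 hpos).re_inner_nonneg_right e

theorem exists_spectralMeasure (hJ : IsSelfAdjoint J) {e : E} (he : ‖e‖ = 1) :
    ∃ (μ : Measure ℝ) (K : ℝ), IsProbabilityMeasure μ ∧ (∀ᵐ x ∂μ, |x| ≤ K) ∧
      ∀ p : Polynomial ℝ, ∫ x, p.eval x ∂μ = (inner ℂ e (Polynomial.aeval J p e)).re := by
  obtain ⟨m, hm⟩ := exists_measure_spectrum hJ e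
  have hpoly (p : Polynomial ℝ) : ∫ x, p.eval x ∂m.map Subtype.val =
      (inner ℂ e (Polynomial.aeval J p e)).re := by
    rw [integral_map measurable_subtype_coe.aemeasurable p.continuous.aestronglyMeasurable,
      ← cfc_polynomial p J hJ, cfc_apply _ _ hJ p.continuous.continuousOn]
    exact hm ⟨_, p.continuous.continuousOn.domRestrict (s := spectrum ℝ J)⟩
  refine ⟨m.map Subtype.val, ‖J‖ * ‖(1 : E →L[ℂ] E)‖, ⟨?_⟩, ?_, hpoly⟩
  · have hmass := hpoly 1
    simp only [Polynomial.eval_one, map_one, one_apply_eq_self, inner_self_eq_norm_sq_to_K, he,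
      integral_const, smul_eq_mul, mul_one] at hmass
    exact (ENNReal.toReal_eq_one_iff _).1 (hmass.trans (by simp))
  · rw [ae_map_iff measurable_subtype_coe.aemeasurable
      (measurableSet_le continuous_abs.measurable measurable_const)]
    exact Filter.Eventually.of_forall fun x => spectrum.norm_le_norm_mul_of_mem x.2

end SpectralMeasure

theorem integrable_eval {μ : Measure ℝ} (hμ : ∀ n : ℕ, Integrable (fun x : ℝ => x ^ n) μ)
    (p : Polynomial ℝ) : Integrable (fun x => p.eval x) μ := by
  induction p using Polynomial.induction_on' with
  | add p q hp hq => simp only [Polynomial.eval_add]; exact hp.add hq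
  | monomial n a => simpa only [Polynomial.eval_monomial] using (hμ n).const_mul a

theorem integrable_pow_of_ae_abs_le {μ : Measure ℝ} [IsFiniteMeasure μ] {K : ℝ}
    (hK : ∀ᵐ x ∂μ, |x| ≤ K) (n : ℕ) : Integrable (fun x : ℝ => x ^ n) μ := by
  refine (integrable_const (K ^ n)).mono' (by fun_prop) ?_
  filter_upwards [hK] with x hx
  rw [norm_pow]
  exact pow_le_pow_left₀ (norm_nonneg x) hx n

/-- The moment functional of a measure with finite moments, as a linear functional on real
polynomials. -/
noncomputable def polyIntegral (μ : Measure ℝ)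
    (hμ : ∀ n : ℕ, Integrable (fun x : ℝ => x ^ n) μ) : Polynomial ℝ →ₗ[ℝ] ℝ where
  toFun p := ∫ x, p.eval x ∂μ
  map_add' p q := by
    simp only [Polynomial.eval_add]
    exact integral_add (integrable_eval hμ p) (integrable_eval hμ q)
  map_smul' c p := by
    simp only [Polynomial.eval_smul, smul_eq_mul, RingHom.id_apply]
    exact integral_const_mul c _

theorem polyIntegral_apply {μ : Measure ℝ} (hμ : ∀ n : ℕ, Integrable (fun x : ℝ => x ^ n) μ)
    (p : Polynomial ℝ) : polyIntegral μ hμ p = ∫ x, p.eval x ∂μ := rfl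

theorem ae_abs_lt_of_integral_pow_le {μ : Measure ℝ} [IsFiniteMeasure μ] {K L : ℝ}
    (hK : 0 ≤ K) (hKL : K < L) (hμ : ∀ n : ℕ, Integrable (fun x : ℝ => x ^ n) μ)
    (hle : ∀ n : ℕ, ∫ x, x ^ (2 * n) ∂μ ≤ K ^ (2 * n)) : ∀ᵐ x ∂μ, |x| < L := by
  have hL : 0 < L := hK.trans_lt hKL
  have htail (n : ℕ) : μ.real {x | L ≤ |x|} ≤ (K ^ 2 / L ^ 2) ^ n := by
    have hsub : {x : ℝ | L ≤ |x|} ⊆ {x | L ^ (2 * n) ≤ x ^ (2 * n)} := fun x hx => by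
      rw [Set.mem_ofPred_eq, ← (even_two_mul n).pow_abs x]
      exact pow_le_pow_left₀ hL.le hx _
    rw [div_pow, ← pow_mul, ← pow_mul, le_div_iff₀ (by positivity), mul_comm]
    calc L ^ (2 * n) * μ.real {x | L ≤ |x|}
        ≤ L ^ (2 * n) * μ.real {x | L ^ (2 * n) ≤ x ^ (2 * n)} :=
          mul_le_mul_of_nonneg_left (measureReal_mono hsub) (by positivity)
      _ ≤ ∫ x, x ^ (2 * n) ∂μ := mul_meas_ge_le_integral_of_nonneg
          (Filter.Eventually.of_forall fun x => (even_two_mul n).pow_nonneg x) (hμ _) _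
      _ ≤ K ^ (2 * n) := hle n
  have hratio : K ^ 2 / L ^ 2 < 1 := by
    rw [div_lt_one (by positivity)]
    exact pow_lt_pow_left₀ hKL hK two_ne_zero
  have hzero : μ.real {x | L ≤ |x|} = 0 :=
    le_antisymm (ge_of_tendsto' (tendsto_pow_atTop_nhds_zero_of_lt_one (by positivity) hratio)
      htail) measureReal_nonneg
  filter_upwards [measure_eq_zero_iff_ae_notMem.1 ((measureReal_eq_zero_iff).1 hzero)] with x hx
  exact not_le.1 hx

theorem abs_integral_eval_sub_integral_le {μ : Measure ℝ} [IsProbabilityMeasure μ] {K ε : ℝ}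
    (hK : ∀ᵐ x ∂μ, |x| ≤ K) {p : Polynomial ℝ} {f : BoundedContinuousFunction ℝ ℝ}
    (hp : ∀ x ∈ Set.Icc (-K) K, |p.eval x - f x| ≤ ε) :
    |∫ x, p.eval x ∂μ - ∫ x, f x ∂μ| ≤ ε := by
  rw [← integral_sub (integrable_eval (integrable_pow_of_ae_abs_le hK) p) (f.integrable μ),
    ← Real.norm_eq_abs]
  refine (norm_integral_le_of_norm_le_const (C := ε) ?_).trans (by simp)
  filter_upwards [hK] with x hx
  exact hp x (abs_le.1 hx)

theorem eq_of_ae_abs_le_of_integral_eval_eq {μ ν : Measure ℝ} [IsProbabilityMeasure μ]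
    [IsProbabilityMeasure ν] {K : ℝ} (hμ : ∀ᵐ x ∂μ, |x| ≤ K) (hν : ∀ᵐ x ∂ν, |x| ≤ K)
    (h : ∀ p : Polynomial ℝ, ∫ x, p.eval x ∂μ = ∫ x, p.eval x ∂ν) : μ = ν := by
  refine ext_of_forall_integral_eq_of_IsFiniteMeasure fun f => eq_of_forall_dist_le fun ε hε => ?_
  obtain ⟨p, hp⟩ := exists_polynomial_near_of_continuousOn (-K) K f f.continuous.continuousOn
    (ε / 2) (half_pos hε)
  have hpμ := abs_integral_eval_sub_integral_le hμ fun x hx => (hp x hx).le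
  have hpν := abs_integral_eval_sub_integral_le hν fun x hx => (hp x hx).le
  rw [h, abs_sub_comm] at hpμ
  calc dist (∫ x, f x ∂μ) (∫ x, f x ∂ν)
      ≤ |∫ x, f x ∂μ - ∫ x, p.eval x ∂ν| + |∫ x, p.eval x ∂ν - ∫ x, f x ∂ν| := abs_sub_le _ _ _
    _ ≤ ε := by linarith

theorem eq_of_integral_eval_eq {μ ν : Measure ℝ} [IsProbabilityMeasure μ]
    [IsProbabilityMeasure ν] {K : ℝ} (hμ : ∀ n : ℕ, Integrable (fun x : ℝ => x ^ n) μ)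
    (hν : ∀ᵐ x ∂ν, |x| ≤ K)
    (h : ∀ p : Polynomial ℝ, ∫ x, p.eval x ∂μ = ∫ x, p.eval x ∂ν) : μ = ν := by
  have hK : 0 ≤ K := by
    obtain ⟨x, hx⟩ := hν.exists
    exact (abs_nonneg x).trans hx
  have hle (n : ℕ) : ∫ x, x ^ (2 * n) ∂μ ≤ K ^ (2 * n) := by
    calc ∫ x, x ^ (2 * n) ∂μ = ∫ x, x ^ (2 * n) ∂ν := by
          simpa using h (Polynomial.X ^ (2 * n))
      _ ≤ ∫ _, K ^ (2 * n) ∂ν := by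
          refine integral_mono_ae (integrable_pow_of_ae_abs_le hν _) (integrable_const _) ?_
          filter_upwards [hν] with x hx
          rw [← (even_two_mul n).pow_abs]
          exact pow_le_pow_left₀ (abs_nonneg x) hx _
      _ = K ^ (2 * n) := by simp
  have hμ' := ae_abs_lt_of_integral_pow_le hK (lt_add_one K) hμ hle
  exact eq_of_ae_abs_le_of_integral_eval_eq (hμ'.mono fun _ => le_of_lt)
    (hν.mono fun _ hx => hx.trans (lt_add_one K).le) h

/-! ### Jacobi parameters -/

section JacobiOperator

variable {E : Type*} [NormedAddCommGroup E] [InnerProductSpace ℂ E]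

theorem eq_of_forall_inner_hilbertBasis {ι : Type*} (e : HilbertBasis ι ℂ E) {x y : E}
    (h : ∀ i, inner ℂ (e i) x = inner ℂ (e i) y) : x = y :=
  e.repr.injective (lp.ext (funext fun i => by simpa only [e.repr_apply_apply] using h i))

theorem exists_diagonal_operator [CompleteSpace E] {ι : Type*} (e : HilbertBasis ι ℂ E)
    {a : ι → ℝ} (ha : BddAbove (Set.range fun i => |a i|)) :
    ∃ A : E →L[ℂ] E, IsSelfAdjoint A ∧ ∀ i, A (e i) = a i • e i := by
  classical
  obtain ⟨K, hK⟩ := ha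
  have hbound (i : ι) : ‖(a i : ℂ) • ContinuousLinearMap.id ℂ ℂ‖ ≤ max K 0 := by
    rw [norm_smul, Complex.norm_real, ContinuousLinearMap.norm_id, mul_one]
    exact (hK ⟨i, rfl⟩).trans (le_max_left K 0)
  let M := lp.mapCLM 2 (fun i => (a i : ℂ) • ContinuousLinearMap.id ℂ ℂ) (le_max_right K 0) hbound
  let A : E →L[ℂ] E := e.repr.symm.toContinuousLinearEquiv.toContinuousLinearMap ∘L M ∘L
    e.repr.toContinuousLinearEquiv.toContinuousLinearMap
  have hcoord (x : E) (i : ι) : inner ℂ (e i) (A x) = a i * inner ℂ (e i) x := by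
    simp [A, M, ← e.repr_apply_apply]
  have hA (i : ι) : A (e i) = a i • e i := by
    refine eq_of_forall_inner_hilbertBasis e fun j => ?_
    rw [hcoord, inner_smul_right_eq_smul, orthonormal_iff_ite.1 e.orthonormal]
    rcases eq_or_ne j i with rfl | h
    · simp
    · simp [h]
  refine ⟨A, ContinuousLinearMap.isSelfAdjoint_iff'.2 (ContinuousLinearMap.ext fun x =>
    eq_of_forall_inner_hilbertBasis e fun j => ?_), hA⟩
  rw [ContinuousLinearMap.adjoint_inner_right, hA, hcoord, inner_smul_left_eq_smul,
    Complex.real_smul]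

theorem exists_shift_operator [CompleteSpace E] (e : HilbertBasis ℕ ℂ E) :
    ∃ S : E →L[ℂ] E, (∀ n, S (e n) = e (n + 1)) ∧ (∀ n, star S (e (n + 1)) = e n) ∧
      star S (e 0) = 0 := by
  have hV := (e.orthonormal.comp _ Nat.succ_injective).orthogonalFamily
  let S : E →L[ℂ] E := (hV.linearIsometry.comp e.repr.toLinearIsometry).toContinuousLinearMap
  have hS (n : ℕ) : S (e n) = e (n + 1) := by
    classical
    change hV.linearIsometry (e.repr (e n)) = e (n + 1)
    rw [e.repr_self, hV.linearIsometry_apply_single]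
    simp
  have hcoord (m n : ℕ) : inner ℂ (e n) (star S (e m)) = if n + 1 = m then 1 else 0 := by
    rw [ContinuousLinearMap.star_eq_adjoint, ContinuousLinearMap.adjoint_inner_right, hS,
      orthonormal_iff_ite.1 e.orthonormal]
  refine ⟨S, hS, fun m => eq_of_forall_inner_hilbertBasis e fun n => ?_,
    eq_of_forall_inner_hilbertBasis e fun n => ?_⟩
  · simp [hcoord, orthonormal_iff_ite.1 e.orthonormal]
  · simp [hcoord]

theorem exists_jacobi_operator [CompleteSpace E] (e : HilbertBasis ℕ ℂ E) {α β : ℕ → ℝ}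
    (hα : BddAbove (Set.range fun n => |α n|)) (hβ : BddAbove (Set.range fun n => |β n|)) :
    ∃ J : E →L[ℂ] E, IsSelfAdjoint J ∧ J (e 0) = α 0 • e 1 + β 0 • e 0 ∧
      ∀ n, J (e (n + 1)) = α (n + 1) • e (n + 2) + β (n + 1) • e (n + 1) + α n • e n := by
  obtain ⟨S, hS, hS', hS0⟩ := exists_shift_operator e
  obtain ⟨A, hA, hAe⟩ := exists_diagonal_operator e hα
  obtain ⟨B, hB, hBe⟩ := exists_diagonal_operator e hβ
  refine ⟨S * A + A * star S + B, ?_, ?_, fun n => ?_⟩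
  · rw [IsSelfAdjoint, star_add, star_add, star_mul, star_mul, star_star, hA.star_eq, hB.star_eq,
      add_comm (A * star S)]
  · simp [hAe, hBe, hS, hS0, ContinuousLinearMap.map_smul_of_tower]
  · simp [hAe, hBe, hS, hS', ContinuousLinearMap.map_smul_of_tower]
    abel

end JacobiOperator

theorem X_mul_jacobiPoly_zero (β γ : ℕ → ℝ) :
    Polynomial.X * jacobiPoly β γ 0 = jacobiPoly β γ 1 + β 0 • jacobiPoly β γ 0 := by
  simp [jacobiPoly, Polynomial.smul_eq_C_mul]

theorem X_mul_jacobiPoly_succ (β γ : ℕ → ℝ) (n : ℕ) :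
    Polynomial.X * jacobiPoly β γ (n + 1) = jacobiPoly β γ (n + 2)
      + β (n + 1) • jacobiPoly β γ (n + 1) + γ (n + 1) • jacobiPoly β γ n := by
  rw [jacobiPoly, Polynomial.smul_eq_C_mul, Polynomial.smul_eq_C_mul]
  ring

theorem linearMap_ext_jacobiPoly {V : Type*} [AddCommGroup V] [Module ℝ V] {β γ : ℕ → ℝ}
    {f g : Polynomial ℝ →ₗ[ℝ] V} (h : ∀ n, f (jacobiPoly β γ n) = g (jacobiPoly β γ n)) :
    f = g := by
  have hshift (k n : ℕ) : f (Polynomial.X ^ k * jacobiPoly β γ n) =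
      g (Polynomial.X ^ k * jacobiPoly β γ n) := by
    induction k generalizing n with
    | zero => simpa using h n
    | succ k ih =>
      rw [pow_succ, mul_assoc]
      cases n with
      | zero => simp only [X_mul_jacobiPoly_zero, mul_add, mul_smul_comm, map_add, map_smul, ih]
      | succ n => simp only [X_mul_jacobiPoly_succ, mul_add, mul_smul_comm, map_add, map_smul, ih]
  refine Polynomial.lhom_ext' fun n => LinearMap.ext_ring ?_
  simpa [jacobiPoly, Polynomial.X_pow_eq_monomial] using hshift n 0

theorem aeval_jacobiPoly_smul {A V : Type*} [Ring A] [Algebra ℝ A] [AddCommGroup V] [Module ℝ V]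
    [Module A V] [IsScalarTower ℝ A V] {J : A} {β γ : ℕ → ℝ} {f : ℕ → V}
    (h0 : J • f 0 = f 1 + β 0 • f 0)
    (hsucc : ∀ n, J • f (n + 1) = f (n + 2) + β (n + 1) • f (n + 1) + γ (n + 1) • f n) (n : ℕ) :
    Polynomial.aeval J (jacobiPoly β γ n) • f 0 = f n := by
  induction n using Nat.twoStepInduction with
  | zero => simp [jacobiPoly]
  | one => simp [jacobiPoly, sub_smul, h0]
  | more n ih ih' =>
    simp only [jacobiPoly, map_sub, map_mul, Polynomial.aeval_X, Polynomial.aeval_C, sub_smul,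
      mul_smul, algebraMap_smul, ih, ih', hsucc]
    abel

theorem inner_aeval_mul_apply {E : Type*} [NormedAddCommGroup E] [InnerProductSpace ℂ E]
    [CompleteSpace E] {J : E →L[ℂ] E} (hJ : IsSelfAdjoint J) (p q : Polynomial ℝ) (e : E) :
    inner ℂ e (Polynomial.aeval J (p * q) e) =
      inner ℂ (Polynomial.aeval J p e) (Polynomial.aeval J q e) := by
  have hp : IsSelfAdjoint (Polynomial.aeval J p) := by
    rw [← cfc_polynomial p J hJ]
    exact cfc_predicate _ J
  rw [map_mul, mul_apply_eq_comp, ← ContinuousLinearMap.adjoint_inner_left, hp.adjoint_eq]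

theorem exists_hasJacobiParameters_of_isSelfAdjoint {E : Type*} [NormedAddCommGroup E]
    [InnerProductSpace ℂ E] [CompleteSpace E] {J : E →L[ℂ] E} (hJ : IsSelfAdjoint J)
    {β γ : ℕ → ℝ} {f : ℕ → E} (hf0 : ‖f 0‖ = 1) (hf : ∀ m n, m ≠ n → inner ℂ (f m) (f n) = 0)
    (h0 : J (f 0) = f 1 + β 0 • f 0)
    (hsucc : ∀ n, J (f (n + 1)) = f (n + 2) + β (n + 1) • f (n + 1) + γ (n + 1) • f n) :
    ∃ (μ : Measure ℝ) (K : ℝ), HasJacobiParameters β γ μ ∧ ∀ᵐ x ∂μ, |x| ≤ K := by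
  obtain ⟨μ, K, hμ, hK, hint⟩ := exists_spectralMeasure hJ hf0
  refine ⟨μ, K, ⟨hμ, integrable_pow_of_ae_abs_le hK, fun m n hmn => ?_⟩, hK⟩
  have hmul := hint (jacobiPoly β γ m * jacobiPoly β γ n)
  have : IsScalarTower ℝ (E →L[ℂ] E) E := ⟨fun _ _ _ => rfl⟩
  have haeval (k : ℕ) : Polynomial.aeval J (jacobiPoly β γ k) (f 0) = f k :=
    aeval_jacobiPoly_smul (J := J) h0 hsucc k
  rw [inner_aeval_mul_apply hJ, haeval, haeval, hf m n hmn] at hmul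
  simpa only [Polynomial.eval_mul, Complex.zero_re] using hmul

theorem exists_hasJacobiParameters {β γ : ℕ → ℝ} (hβ : BddAbove (Set.range fun n => |β n|))
    (hγ : BddAbove (Set.range γ)) (hγ0 : ∀ n, 0 ≤ γ (n + 1)) :
    ∃ (μ : Measure ℝ) (K : ℝ), HasJacobiParameters β γ μ ∧ ∀ᵐ x ∂μ, |x| ≤ K := by
  let e : HilbertBasis ℕ ℂ (lp (fun _ : ℕ => ℂ) 2) := default
  let α : ℕ → ℝ := fun n => √(γ (n + 1))
  have hα : BddAbove (Set.range fun n => |α n|) := by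
    obtain ⟨K, hK⟩ := hγ
    refine ⟨√K, ?_⟩
    rintro _ ⟨n, rfl⟩
    exact (abs_of_nonneg (Real.sqrt_nonneg _)).trans_le (Real.sqrt_le_sqrt (hK ⟨n + 1, rfl⟩))
  obtain ⟨J, hJ, hJ0, hJsucc⟩ := exists_jacobi_operator e hα hβ
  let κ : ℕ → ℝ := fun n => ∏ k ∈ Finset.range n, α k
  have hκ (n : ℕ) : κ (n + 1) = κ n * α n := Finset.prod_range_succ _ _
  have hαsq (n : ℕ) : α n * α n = γ (n + 1) := Real.mul_self_sqrt (hγ0 n)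
  refine exists_hasJacobiParameters_of_isSelfAdjoint hJ (f := fun n => κ n • e n) ?_
    (fun m n hmn => ?_) ?_ fun n => ?_
  · simp [κ, e.orthonormal.1 0]
  · rw [inner_smul_left_eq_smul, inner_smul_right_eq_smul, e.orthonormal.2 hmn, smul_zero,
      smul_zero]
  · simp only [κ, Finset.prod_range_zero, Finset.prod_range_one, one_smul]
    exact hJ0
  · rw [ContinuousLinearMap.map_smul_of_tower J, hJsucc, hκ (n + 1), hκ n, ← hαsq]
    module

namespace HasJacobiParameters

variable {β γ : ℕ → ℝ} {μ ν : Measure ℝ}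

theorem integral_jacobiPoly (h : HasJacobiParameters β γ μ) (n : ℕ) :
    ∫ x, (jacobiPoly β γ n).eval x ∂μ = if n = 0 then 1 else 0 := by
  have := h.isProb
  split_ifs with hn
  · subst hn
    simp [jacobiPoly]
  · simpa [jacobiPoly] using h.orthogonal 0 n (Ne.symm hn)

theorem integral_eval_eq (hμ : HasJacobiParameters β γ μ) (hν : HasJacobiParameters β γ ν)
    (p : Polynomial ℝ) : ∫ x, p.eval x ∂μ = ∫ x, p.eval x ∂ν := by
  have h : polyIntegral μ hμ.moments = polyIntegral ν hν.moments :=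
    linearMap_ext_jacobiPoly (β := β) (γ := γ) fun n =>
      (hμ.integral_jacobiPoly n).trans (hν.integral_jacobiPoly n).symm
  exact LinearMap.congr_fun h p

end HasJacobiParameters

theorem existsUnique_hasJacobiParameters {β γ : ℕ → ℝ}
    (hβ : BddAbove (Set.range fun n => |β n|)) (hγ : BddAbove (Set.range γ))
    (hγ0 : ∀ n, 0 ≤ γ (n + 1)) : ∃! μ : Measure ℝ, HasJacobiParameters β γ μ := by
  obtain ⟨ν, K, hν, hK⟩ := exists_hasJacobiParameters hβ hγ hγ0
  refine ⟨ν, hν, fun μ hμ => ?_⟩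
  have := hμ.isProb
  have := hν.isProb
  exact eq_of_integral_eval_eq hμ.moments hK (hμ.integral_eval_eq hν)

theorem existsUnique_isFreeMeixner (b : ℝ) {c : ℝ} (hc : -1 ≤ c) :
    ∃! μ : Measure ℝ, IsFreeMeixner b c μ := by
  refine existsUnique_hasJacobiParameters ⟨|b|, ?_⟩ ⟨max 1 (1 + c), ?_⟩ fun n => ?_
  · rintro _ ⟨n, rfl⟩
    dsimp only
    split_ifs <;> simp
  · rintro _ ⟨n, rfl⟩
    dsimp only
    split_ifs <;> simp
  · split_ifs
    exacts [zero_le_one, by linarith]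

/-! ### The Bernoulli distribution -/

theorem jacobiPoly_dvd_of_eq_zero {β γ : ℕ → ℝ} {k : ℕ} (h : γ (k + 1) = 0) (m : ℕ) :
    jacobiPoly β γ (k + 1) ∣ jacobiPoly β γ (k + 1 + m) := by
  induction m using Nat.twoStepInduction with
  | zero => exact dvd_rfl
  | one =>
    rw [jacobiPoly, h, map_zero, zero_mul, sub_zero]
    exact dvd_mul_left _ _
  | more m ih ih' =>
    rw [← add_assoc, jacobiPoly]
    exact dvd_sub (ih'.mul_left _) (ih.mul_left _)

theorem integrable_bernoulliSym (f : ℝ → ℝ) : Integrable f bernoulliSym :=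
  ((integrable_dirac (by simp)).smul_measure (by simp)).add_measure
    ((integrable_dirac (by simp)).smul_measure (by simp))

theorem integral_bernoulliSym (f : ℝ → ℝ) : ∫ x, f x ∂bernoulliSym = (f (-1) + f 1) / 2 := by
  obtain ⟨hneg, hpos⟩ := integrable_add_measure.1 (integrable_bernoulliSym f)
  rw [bernoulliSym, integral_add_measure hneg hpos, integral_smul_measure, integral_smul_measure,
    integral_dirac, integral_dirac]
  simp only [one_div, ENNReal.toReal_inv, ENNReal.toReal_ofNat, smul_eq_mul]
  ring

theorem isFreeMeixner_bernoulliSym : IsFreeMeixner 0 (-1) bernoulliSym := by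
  refine ⟨⟨by simp [bernoulliSym, ENNReal.inv_two_add_inv_two]⟩,
    fun n => integrable_bernoulliSym _, fun m n hmn => ?_⟩
  wlog hlt : m < n generalizing m n
  · simpa only [mul_comm] using this n m hmn.symm (hmn.lt_or_gt.resolve_left hlt)
  rw [integral_bernoulliSym]
  rcases lt_or_ge n 2 with hn | hn
  · obtain ⟨rfl, rfl⟩ : m = 0 ∧ n = 1 := by omega
    simp [jacobiPoly]
  · obtain ⟨k, rfl⟩ := Nat.exists_eq_add_of_le hn
    obtain ⟨q, hq⟩ := jacobiPoly_dvd_of_eq_zero (β := fun n => if n = 0 then 0 else 0)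
      (γ := fun n => if n = 1 then 1 else 1 + -1) (k := 1) (by norm_num) k
    rw [hq]
    simp [jacobiPoly]

/-! ### Free Meixner distributions as free Meixner states -/

namespace NCFunctional

open NCSeries

/-- The matrix `T_1 = (b)`, for the parameter `b` of a free Meixner distribution. -/
noncomputable def scalarT (b : ℝ) : Fin 1 → Matrix (Fin 1) (Fin 1) ℂ := fun _ => (b : ℂ) • 1

/-- The matrix `C = (c)`, for the parameter `c` of a free Meixner distribution. -/
def scalarC (c : ℝ) : Matrix (Fin 1) (Fin 1) ℝ := Matrix.of fun _ _ => c

/-- A functional on `ℂ⟨x_1⟩ = ℂ[x]`, restricted to the polynomials with real coefficients. -/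
noncomputable def onReal (φ : NCFunctional 1) : Polynomial ℝ →ₗ[ℝ] ℂ where
  toFun p := φ (Polynomial.aeval (FreeAlgebra.ι ℂ 0) p)
  map_add' p q := by rw [map_add, map_add]
  map_smul' r p := by rw [map_smul]; exact φ.map_smul_of_tower r _

theorem onReal_apply (φ : NCFunctional 1) (p : Polynomial ℝ) :
    φ.onReal p = φ (Polynomial.aeval (FreeAlgebra.ι ℂ 0) p) := rfl

theorem onReal_X_pow (φ : NCFunctional 1) (n : ℕ) :
    φ.onReal (Polynomial.X ^ n) = φ (monomial (List.replicate n 0)) := by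
  rw [onReal_apply, map_pow, Polynomial.aeval_X, monomial, List.map_replicate, List.prod_replicate]

theorem ext_onReal {φ ψ : NCFunctional 1} (h : φ.onReal = ψ.onReal) : φ = ψ := by
  refine ext_monomial fun u => ?_
  have hu : u = List.replicate u.length 0 :=
    List.eq_replicate_iff.2 ⟨rfl, fun x _ => Subsingleton.elim x 0⟩
  rw [hu, ← onReal_X_pow, h, onReal_X_pow]

theorem aeval_position_jacobiPoly (b c : ℝ) (n : ℕ) :
    Polynomial.aeval (Fock.position (scalarT b) (Matrix.of fun i j => 1 + scalarC c i j) 0)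
      (jacobiPoly (fun n => if n = 0 then 0 else b) (fun n => if n = 1 then 1 else 1 + c) n)
        (Finsupp.single [] 1) = Finsupp.single (List.replicate n 0) (1 : ℂ) := by
  refine aeval_jacobiPoly_smul (A := Module.End ℂ (List (Fin 1) →₀ ℂ))
    (f := fun n => Finsupp.single (List.replicate n (0 : Fin 1)) (1 : ℂ)) ?_ (fun n => ?_) n
  · simp [Fock.position, Fock.creation, Fock.gauge, Fock.annihilation]
  · cases n <;>
      simp [Fock.position, Fock.creation, Fock.gauge, Fock.annihilation, Fock.stepWeight,
        List.replicate_succ, scalarT, scalarC, -Finsupp.single_mul]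

theorem onReal_jacobiPoly {b c : ℝ} {φ : NCFunctional 1} (hφ : φ 1 = 1)
    (h : IsMeixnerSeries (scalarT b) (scalarC c) φ.R) (n : ℕ) :
    φ.onReal (jacobiPoly (fun n => if n = 0 then 0 else b) (fun n => if n = 1 then 1 else 1 + c) n)
      = if n = 0 then 1 else 0 := by
  have hlift (p : Polynomial ℝ) : FreeAlgebra.lift ℂ
      (Fock.position (scalarT b) (Matrix.of fun i j => 1 + scalarC c i j))
        (Polynomial.aeval (FreeAlgebra.ι ℂ 0) p) =
      Polynomial.aeval
        (Fock.position (scalarT b) (Matrix.of fun i j => 1 + scalarC c i j) 0) p := by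
    rw [← FreeAlgebra.lift_ι_apply (R := ℂ) (Fock.position (scalarT b) _) 0]
    exact (Polynomial.aeval_algHom_apply (AlgHom.restrictScalars ℝ (FreeAlgebra.lift ℂ _)) _ p).symm
  rw [onReal_apply, apply_eq_vacuum hφ (isMeixnerSeries_eta_iff.2 h), hlift,
    aeval_position_jacobiPoly, weightedForm_single_left]
  cases n <;> simp [Fock.weight, List.replicate_succ]

theorem onReal_ofMeasure {μ : Measure ℝ} [IsProbabilityMeasure μ]
    (hμ : ∀ n : ℕ, Integrable (fun x : ℝ => x ^ n) μ) (p : Polynomial ℝ) :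
    (ofMeasure μ).onReal p = ((∫ x, p.eval x ∂μ : ℝ) : ℂ) := by
  suffices h : (ofMeasure μ).onReal = Complex.ofRealCLM.toLinearMap ∘ₗ polyIntegral μ hμ from
    LinearMap.congr_fun h p
  refine Polynomial.lhom_ext' fun n => LinearMap.ext_ring ?_
  rw [LinearMap.comp_apply, LinearMap.comp_apply, Polynomial.monomial_one_right_eq_X_pow,
    onReal_X_pow, LinearMap.comp_apply, polyIntegral_apply]
  refine (ofMoments_monomial _ _).trans ?_
  cases n <;> simp [List.replicate_succ]

theorem eq_ofMeasure {b c : ℝ} {μ : Measure ℝ} (hμ : IsFreeMeixner b c μ) {φ : NCFunctional 1}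
    (hφ : φ 1 = 1) (h : IsMeixnerSeries (scalarT b) (scalarC c) φ.R) : φ = ofMeasure μ := by
  have := hμ.isProb
  refine ext_onReal (linearMap_ext_jacobiPoly fun n => (onReal_jacobiPoly hφ h n).trans ?_)
  rw [onReal_ofMeasure hμ.moments, HasJacobiParameters.integral_jacobiPoly hμ]
  split_ifs <;> simp

theorem isMeixnerSeries_R_ofMeasure {b c : ℝ} {μ : Measure ℝ} (hμ : IsFreeMeixner b c μ) :
    IsMeixnerSeries (scalarT b) (scalarC c) (ofMeasure μ).R := by
  obtain ⟨h, hh, -⟩ := existsUnique_isMeixnerSeries (scalarT b) (scalarC c)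
  rw [← R_ofR hh.nil] at hh
  rwa [← eq_ofMeasure hμ (ofMoments_one _) hh]

theorem Phi_ofMeasure {b c α t : ℝ} {μ ν : Measure ℝ} (hμ : IsFreeMeixner b c μ)
    (hν : IsFreeMeixner (b + α) (c + t) ν) :
    Phi (ofMeasure μ) (((ofMeasure μ).boxpow (1 + t)).boxplus (delta fun _ => α)) =
      ofMeasure ν := by
  refine eq_ofMeasure hν (ofEta_one _) ?_
  have hT : (fun i => (α : ℂ) • (1 : Matrix (Fin 1) (Fin 1) ℂ) + scalarT b i) =
      scalarT (b + α) := by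
    funext i
    rw [scalarT, scalarT, ← add_smul, Complex.ofReal_add, add_comm]
  have hC : (Matrix.of fun i j => t + scalarC c i j) = scalarC (c + t) := by
    ext
    exact add_comm t c
  rw [← hT, ← hC, ← isMeixnerSeries_eta_iff]
  exact isMeixnerSeries_eta_Phi (isMeixnerSeries_R_ofMeasure hμ) _ t

theorem BT_ofMeasure {b c α t : ℝ} (ht : t ≠ -1) {μ ν : Measure ℝ} (hμ : IsFreeMeixner b c μ)
    (hν : IsFreeMeixner (b + α) (c + t) ν) :
    BT (fun _ => α) t (ofMeasure μ) = ofMeasure ν := by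
  rw [BT_eq_Phi _ _ ht, Phi_ofMeasure hμ hν]

end NCFunctional

open scoped Kronecker in
theorem mainTheorem6 :
    -- the free Meixner distributions `μ_{b, c}`, `b ∈ ℝ`, `1 + c ≥ 0`, are well defined
    (∀ b c : ℝ, -1 ≤ c → ∃! μ : Measure ℝ, IsFreeMeixner b c μ) ∧
    -- the free Meixner states `φ_{{T_i}, C}` are well defined
    (∀ (d : ℕ) (T : Fin d → Matrix (Fin d) (Fin d) ℂ) (C : Matrix (Fin d) (Fin d) ℝ),
      (∀ i, (T i).IsHermitian) → (∀ i j, -1 ≤ C i j) →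
      (∀ i, Commute (T i ⊗ₖ (1 : Matrix (Fin d) (Fin d) ℂ))
        (Matrix.diagonal fun p : Fin d × Fin d => (C p.1 p.2 : ℂ))) →
      ∃! φ : NCFunctional d, NCFunctional.IsFreeMeixnerState T C φ) ∧
    -- `B_{α, t}[μ_{b, c}] = μ_{b + α, c + t}`
    (∀ b c α t : ℝ, -1 ≤ c → -1 ≤ c + t → t ≠ -1 →
      ∀ μ : Measure ℝ, IsFreeMeixner b c μ →
      ∃ ν : Measure ℝ, IsFreeMeixner (b + α) (c + t) ν ∧
        NCFunctional.BT (fun _ => α) t (NCFunctional.ofMeasure μ) = NCFunctional.ofMeasure ν) ∧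
    -- `B_{a, t}[φ_{{T_i}, C}] = φ_{{a_i I + T_i}, t I + C}`
    (∀ (d : ℕ) (T : Fin d → Matrix (Fin d) (Fin d) ℂ) (C : Matrix (Fin d) (Fin d) ℝ)
      (a : Fin d → ℝ) (t : ℝ), (∀ i j, -1 ≤ t + C i j) → t ≠ -1 →
      ∀ φ : NCFunctional d, NCFunctional.IsFreeMeixnerState T C φ →
      NCFunctional.IsFreeMeixnerState
        (fun i => (a i : ℂ) • (1 : Matrix (Fin d) (Fin d) ℂ) + T i)
        (Matrix.of fun i j => t + C i j) (NCFunctional.BT a t φ)) ∧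
    -- every `μ_{b, c}` comes from the Bernoulli distribution
    (IsFreeMeixner 0 (-1) bernoulliSym ∧
      ∀ b c : ℝ, -1 ≤ c → ∀ μ : Measure ℝ, IsFreeMeixner b c μ →
      ∃ α t : ℝ, 0 ≤ t ∧ NCFunctional.BT (fun _ => α) t (NCFunctional.ofMeasure bernoulliSym) =
        NCFunctional.ofMeasure μ) ∧
    -- `Φ[μ_{b, c}, μ_{b, c}^{⊞ (1 + t)} ⊞ δ_α] = B_{α, t}[μ_{b, c}] = μ_{b + α, c + t}`
    (∀ b c α t : ℝ, -1 ≤ c → -1 ≤ c + t →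
      ∀ μ : Measure ℝ, IsFreeMeixner b c μ →
      ∃ ν : Measure ℝ, IsFreeMeixner (b + α) (c + t) ν ∧
        NCFunctional.Phi (NCFunctional.ofMeasure μ)
          (((NCFunctional.ofMeasure μ).boxpow (1 + t)).boxplus
            (NCFunctional.delta fun _ => α)) = NCFunctional.ofMeasure ν ∧
        (t ≠ -1 → NCFunctional.BT (fun _ => α) t (NCFunctional.ofMeasure μ) =
          NCFunctional.ofMeasure ν)) := by
  refine ⟨fun b c hc => existsUnique_isFreeMeixner b hc,
    fun d T C hT hC hTC => NCFunctional.existsUnique_isFreeMeixnerState hT hC fun i =>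
      NCFunctional.mul_comm_of_commute_kronecker (hTC i),
    fun b c α t _ hct ht μ hμ => ?_, fun d T C a t hC ht φ hφ => ?_,
    ⟨isFreeMeixner_bernoulliSym, fun b c hc μ hμ => ?_⟩, fun b c α t _ hct μ hμ => ?_⟩
  · obtain ⟨ν, hν, -⟩ := existsUnique_isFreeMeixner (b + α) hct
    exact ⟨ν, hν, NCFunctional.BT_ofMeasure ht hμ hν⟩
  · rw [NCFunctional.BT_eq_Phi _ _ ht]
    exact NCFunctional.isFreeMeixnerState_Phi hC hφ
  · refine ⟨b, c + 1, by linarith,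
      NCFunctional.BT_ofMeasure (by linarith) isFreeMeixner_bernoulliSym ?_⟩
    rwa [zero_add, neg_add_cancel_comm_assoc]
  · obtain ⟨ν, hν, -⟩ := existsUnique_isFreeMeixner (b + α) hct
    exact ⟨ν, hν, NCFunctional.Phi_ofMeasure hμ hν,
      fun ht => NCFunctional.BT_ofMeasure ht hμ hν⟩
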